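/- Let $d\ge 1$ be an integer, let $s>0$ and $p$ be real, and assume $p>2$ if $d\le 2s$, and $2<p\le \frac{2d}{d-2s}$ if $d>2s$. Functions are complex-valued, and $\mathbb T^d=(\mathbb R/\mathbb Z)^d$ carries Lebesgue measure of total mass $1$. With $\widehat u(\xi)=\int_{\mathbb R^d}u(x)e^{-2\pi i x\cdot\xi}\,dx$ (extended to $L^2(\mathbb R^d)$ by Plancherel) and $\widehat u(n)=\int_{\mathbb T^d}u(x)e^{-2\pi i n\cdot x}\,dx$, put $$\|u\|_{\dot H^s(\mathbb R^d)}^2=\int_{\mathbb R^d}(2\pi|\xi|)^{2s}|\widehat u(\xi)|^2\,d\xi,\qquad \|u\|_{\dot H^s(\mathbb T^d)}^2=\sum_{n\in\mathbb Z^d\setminus\{0\}}(2\pi|n|)^{2s}|\widehat u(n)|^2 ,$$ let $H^s(\mathbb R^d)$ and $H^s(\mathbb T^d)$ be the usual $L^2$-based Sobolev spaces, and let $C_{\mathrm{GNS}}(d,p,s)$ be the sharp constant of the Gagliardo–Nirenberg–Sobolev inequality on $\mathbb R^d$, $$C_{\mathrm{GNS}}(d,p,s)^{-1}=\inf_{u\in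 H^s(\mathbb R^d),\,u\ne0}\frac{\|u\|_{\dot H^s(\mathbb R^d)}^{\frac{(p-2)d}{2s}}\,\|u\|_{L^2(\mathbb R^d)}^{2+\frac{p-2}{2s}(2s-d)}}{\|u\|_{L^p(\mathbb R^d)}^p}.$$ Then $0<C_{\mathrm{GNS}}(d,p,s)<\infty$, and for every $\delta>0$ there is a constant $C(\delta)>0$ (depending only on $\delta,d,p,s$) such that $$\|u\|_{L^p(\mathbb T^d)}^p\le\big(C_{\mathrm{GNS}}(d,p,s)+\delta\big)\,\|u\|_{\dot H^s(\mathbb T^d)}^{\frac{(p-2)d}{2s}}\,\|u\|_{L^2(\mathbb T^d)}^{2+\frac{p-2}{2s}(2s-d)}+C(\delta)\,\|u\|_{L^2(\mathbb T^d)}^p$$ for all $u\in H^s(\mathbb T^d)$. -/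

import Mathlib

open MeasureTheory FourierTransform
open scoped ENNReal NNReal

noncomputable section

namespace GNS

/-! ### Sobolev spaces and the sharp constant on `ℝᵈ` -/

/-- The complex Hilbert space `L²(ℝᵈ)` (Lebesgue measure). -/
abbrev L2Rd (d : ℕ) : Type :=
  Lp ℂ 2 (volume : Measure (EuclideanSpace ℝ (Fin d)))

/-- `u ∈ H^s(ℝᵈ)`: the integral `∫ (1 + |2πξ|²)^s |û(ξ)|² dξ` is finite, where `û` is the
(Plancherel) Fourier transform of `u ∈ L²(ℝᵈ)`, with kernel `e^{-2πi x·ξ}`. -/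
def MemHsRd {d : ℕ} (s : ℝ) (u : L2Rd d) : Prop :=
  ∫⁻ ξ, ENNReal.ofReal ((1 + (2 * Real.pi * ‖ξ‖) ^ 2) ^ s) * ‖(𝓕 u : L2Rd d) ξ‖ₑ ^ 2 < ∞

/-- The homogeneous norm `‖u‖_{Ḣ^s(ℝᵈ)} = (∫ (2π|ξ|)^{2s} |û(ξ)|² dξ)^{1/2}`. -/
def hsNormRd {d : ℕ} (s : ℝ) (u : L2Rd d) : ℝ≥0∞ :=
  (∫⁻ ξ, ENNReal.ofReal ((2 * Real.pi * ‖ξ‖) ^ (2 * s)) * ‖(𝓕 u : L2Rd d) ξ‖ₑ ^ 2) ^ (1 / 2 : ℝ)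

/-- The Gagliardo–Nirenberg–Sobolev quotient
`J(u) = ‖u‖_{Ḣ^s}^{(p-2)d/(2s)} ‖u‖_{L²}^{2+(p-2)(2s-d)/(2s)} / ‖u‖_{L^p}^p` on `ℝᵈ`. -/
def quotientJ (d : ℕ) (p s : ℝ) (u : L2Rd d) : ℝ≥0∞ :=
  hsNormRd s u ^ ((p - 2) * d / (2 * s)) *
      eLpNorm u 2 volume ^ (2 + (p - 2) / (2 * s) * (2 * s - d)) /
    eLpNorm u (ENNReal.ofReal p) volume ^ p

/-- The sharp constant: `C_GNS(d,p,s)⁻¹ = inf {J(u) : u ∈ H^s(ℝᵈ), u ≠ 0}`. -/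
def sharpConst (d : ℕ) (p s : ℝ) : ℝ≥0∞ :=
  (⨅ (u : L2Rd d) (_ : MemHsRd s u) (_ : u ≠ 0), quotientJ d p s u)⁻¹

/-! ### Sobolev spaces on `𝕋ᵈ = (ℝ/ℤ)ᵈ` -/

/-- The Lebesgue (Haar probability) measure on `𝕋ᵈ = (ℝ/ℤ)ᵈ`. -/
abbrev torusMeasure (d : ℕ) : Measure (UnitAddTorus (Fin d)) :=
  Measure.pi fun _ => AddCircle.haarAddCircle

/-- The complex Hilbert space `L²(𝕋ᵈ)`. -/
abbrev L2Td (d : ℕ) : Type := Lp ℂ 2 (torusMeasure d)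

/-- The Euclidean length `|n|` of a frequency `n ∈ ℤᵈ`. -/
def freqNorm {d : ℕ} (n : Fin d → ℤ) : ℝ := √(∑ i, (n i : ℝ) ^ 2)

/-- `u ∈ H^s(𝕋ᵈ)`: the sum `∑_{n ∈ ℤᵈ} (1 + |2πn|²)^s |û(n)|²` is finite, where
`û(n) = ∫_{𝕋ᵈ} u(x) e^{-2πi n·x} dx`. -/
def MemHsTd {d : ℕ} (s : ℝ) (u : L2Td d) : Prop :=
  ∑' n : Fin d → ℤ, ENNReal.ofReal ((1 + (2 * Real.pi * freqNorm n) ^ 2) ^ s) *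
    ‖UnitAddTorus.mFourierCoeff u n‖ₑ ^ 2 < ∞

/-- The homogeneous (semi)norm
`‖u‖_{Ḣ^s(𝕋ᵈ)} = (∑_{n ∈ ℤᵈ, n ≠ 0} (2π|n|)^{2s} |û(n)|²)^{1/2}`. -/
def hsNormTd {d : ℕ} (s : ℝ) (u : L2Td d) : ℝ≥0∞ :=
  (∑' n : {n : Fin d → ℤ // n ≠ 0},
    ENNReal.ofReal ((2 * Real.pi * freqNorm n.1) ^ (2 * s)) *
      ‖UnitAddTorus.mFourierCoeff u n.1‖ₑ ^ 2) ^ (1 / 2 : ℝ)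

end GNS

end

/-!
The torus inequality is transferred from `ℝᵈ` by a single cutoff and an average over translations.
Let `u` be a trigonometric polynomial and `0 ≤ φ ≤ 1` a smooth function supported in the unit cube.
The inequality on `ℝᵈ`, with its sharp constant, applies to `φ u`. Obviously
`‖φ u‖_{L²} ≤ ‖u‖_{L²(𝕋ᵈ)}`, and the commutator estimate `GNS.exists_hsNormRd_cutoffPoly_le` gives
`‖φ u‖_{Ḣ^s} ≤ (1 + ε) ‖u‖_{Ḣ^s(𝕋ᵈ)} + C ‖u‖_{L²(𝕋ᵈ)}`. These bounds do not change when `u` is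
translated, while the average of `‖φ u(· + a)‖_{L^p}^p` over `a ∈ 𝕋ᵈ` is `(∫ φ^p) ‖u‖_{L^p(𝕋ᵈ)}^p`.
Choosing `φ` close to the indicator function of the cube, so that `∫ φ^p ≥ 1 - ε`, one obtains the
inequality for `u` (`GNS.exists_torusPoly_le`). Since the bounds are uniform, it passes to general
functions by Fatou's lemma applied to Fourier partial sums
(`GNS.lintegral_rpow_le_of_torusPoly_le`).

Finiteness of the sharp constant is the Gagliardo–Nirenberg–Sobolev inequality with a non-sharp
constant. With `σ = d/2 - d/p`, the hypotheses say `0 < σ ≤ s` and `2σ < d`, and `p` is the critical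
exponent of `Ḣ^σ`. Thus the inequality follows from the critical Sobolev inequality
(`GNS.exists_lintegral_rpow_le_critical`) and the interpolation of `Ḣ^σ` between `L²` and `Ḣ^s`.
Positivity of the sharp constant only needs one nonzero function in `H^s(ℝᵈ)`, for instance a cutoff
function.
-/

noncomputable section

namespace GNS

/-! ### The critical Sobolev inequality on `ℝᵈ` -/

section Sobolev

variable {V : Type*} [NormedAddCommGroup V] [InnerProductSpace ℝ V] [FiniteDimensional ℝ V]
  [MeasurableSpace V] [BorelSpace V]

/-- On `L¹ ∩ L²` the Plancherel inverse Fourier transform is given by the integral formula. Both sides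
define the same tempered distribution, hence agree almost everywhere. -/
theorem fourierInv_ae_eq_integral (g : Lp ℂ 2 (volume : Measure V)) (hg : Integrable g) :
    (𝓕⁻ g : Lp ℂ 2 (volume : Measure V)) =ᵐ[volume] 𝓕⁻ (g : V → ℂ) := by
  have hbd : ∀ x, ‖𝓕⁻ (g : V → ℂ) x‖ ≤ ∫ ξ, ‖g ξ‖ := fun x =>
    VectorFourier.norm_fourierIntegral_le_integral_norm _ _ _ _ _
  have hcont : Continuous (𝓕⁻ (g : V → ℂ)) :=
    VectorFourier.fourierIntegral_continuous Real.continuous_fourierChar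
      (show Continuous fun p : V × V => -inner ℝ p.1 p.2 from continuous_inner.neg) hg
  refine ae_eq_of_integral_contDiff_smul_eq
    ((Lp.memLp _).locallyIntegrable (by norm_num)) hcont.locallyIntegrable fun φ hφ hφc => ?_
  have hφ' : ContDiff ℝ (⊤ : ℕ∞) (fun x => (φ x : ℂ)) := Complex.ofRealCLM.contDiff.comp hφ
  have hφc' : HasCompactSupport (fun x => (φ x : ℂ)) :=
    hφc.comp_left (g := fun t : ℝ => (t : ℂ)) Complex.ofReal_zero
  set ψ : SchwartzMap V ℂ := hφc'.toSchwartzMap hφ' with hψ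
  have hψφ : ∀ x, ψ x = φ x := fun x => rfl
  have h1 := congrArg (fun T => T ψ) (Lp.fourierInv_toTemperedDistribution_eq g)
  simp only [TemperedDistribution.fourierInv_apply, Lp.toTemperedDistribution_apply] at h1
  have h2 : ∫ x, (𝓕⁻ ψ) x • g x = ∫ x, ψ x • 𝓕⁻ (g : V → ℂ) x := by
    have := VectorFourier.integral_fourierIntegral_smul_eq_flip (L := -innerₗ V) (μ := volume)
      (ν := volume) Real.continuous_fourierChar
      (show Continuous fun p : V × V => -inner ℝ p.1 p.2 from continuous_inner.neg)
      (ψ.integrable (μ := volume)) hg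
    rw [SchwartzMap.fourierInv_coe]
    have hflip : (-innerₗ V).flip = -innerₗ V := by
      ext x y; simp [real_inner_comm]
    rw [hflip] at this
    exact this
  rw [h2] at h1
  simpa only [hψφ, Complex.real_smul, smul_eq_mul] using h1.symm

theorem fourierInv_ae_enorm_le (g : Lp ℂ 2 (volume : Measure V)) (hg : ∫⁻ ξ, ‖g ξ‖ₑ < ∞) :
    ∀ᵐ x, ‖(𝓕⁻ g : Lp ℂ 2 (volume : Measure V)) x‖ₑ ≤ ∫⁻ ξ, ‖g ξ‖ₑ := by
  have hi : Integrable g := ⟨Lp.aestronglyMeasurable g, hg⟩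
  filter_upwards [fourierInv_ae_eq_integral g hi] with x hx
  rw [hx, Real.fourierInv_eq]
  refine (enorm_integral_le_lintegral_enorm _).trans ?_
  simp only [Circle.smul_def, smul_eq_mul, ← ofReal_norm, norm_mul, Circle.norm_coe, one_mul,
    le_refl]

/-- Integrability of `‖ξ‖^{-2σ}` near the origin for `2σ < dim V`, with the dependence on the radius
obtained by scaling from the unit ball. -/
theorem exists_lintegral_ball_norm_rpow_le [Nontrivial V] {σ : ℝ}
    (hσ : 2 * σ < Module.finrank ℝ V) :
    ∃ C : ℝ≥0, ∀ A : ℝ, 0 < A →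
      ∫⁻ ξ in Metric.ball (0 : V) A, ENNReal.ofReal (‖ξ‖ ^ (-(2 * σ))) ≤
        C * ENNReal.ofReal (A ^ (Module.finrank ℝ V - 2 * σ)) := by
  have hm : Measurable fun ξ : V => ‖ξ‖ ^ (-(2 * σ)) := by fun_prop
  have hint : IntegrableOn (fun ξ : V => ‖ξ‖ ^ (-(2 * σ))) (Metric.ball 0 1) :=
    integrableOn_ball_of_norm_le_rpow (C := 1) (Module.finrank_pos) hσ
      (ae_of_all _ fun x => by simp [abs_of_nonneg (Real.rpow_nonneg (norm_nonneg x) _)])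
      hm.aestronglyMeasurable
  have hfin : ∫⁻ ξ in Metric.ball (0 : V) 1, ENNReal.ofReal (‖ξ‖ ^ (-(2 * σ))) < ∞ :=
    hint.lintegral_lt_top
  refine ⟨(∫⁻ ξ in Metric.ball (0 : V) 1, ENNReal.ofReal (‖ξ‖ ^ (-(2 * σ)))).toNNReal,
    fun A hA => ?_⟩
  rw [ENNReal.coe_toNNReal hfin.ne]
  have hmap := Measure.map_addHaar_smul (volume : Measure V) (inv_ne_zero hA.ne')
  have hmeas : MeasurableEmbedding (fun x : V => A⁻¹ • x) :=
    (Homeomorph.smulOfNeZero A⁻¹ (inv_ne_zero hA.ne')).measurableEmbedding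
  have key : ∫⁻ ξ in Metric.ball (0 : V) 1, ENNReal.ofReal (‖ξ‖ ^ (-(2 * σ)))
      ∂(Measure.map (fun x : V => A⁻¹ • x) volume) =
      ∫⁻ ξ in Metric.ball (0 : V) A, ENNReal.ofReal (‖A⁻¹ • ξ‖ ^ (-(2 * σ))) := by
    rw [hmeas.restrict_map, hmeas.lintegral_map]
    congr 2
    ext x
    simp [norm_smul, abs_of_pos hA, inv_mul_lt_iff₀ hA]
  rw [hmap, Measure.restrict_smul, lintegral_smul_measure] at key
  have h2 : ∀ ξ : V, ENNReal.ofReal (‖ξ‖ ^ (-(2 * σ))) =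
      ENNReal.ofReal (A ^ (-(2 * σ))) * ENNReal.ofReal (‖A⁻¹ • ξ‖ ^ (-(2 * σ))) := by
    intro ξ
    rw [← ENNReal.ofReal_mul (by positivity), norm_smul, Real.norm_eq_abs,
      abs_of_pos (inv_pos.2 hA), ← Real.mul_rpow hA.le (by positivity), mul_inv_cancel_left₀ hA.ne']
  rw [lintegral_congr h2]
  rw [lintegral_const_mul' _ _ ENNReal.ofReal_ne_top, ← key]
  rw [smul_eq_mul, ← mul_assoc, ← ENNReal.ofReal_mul (by positivity), mul_comm]
  apply le_of_eq
  congr 2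
  rw [inv_pow, inv_inv, abs_of_pos (by positivity), ← Real.rpow_natCast, ← Real.rpow_add hA]
  congr 1
  ring

theorem lintegral_enorm_sq_eq {α : Type*} [MeasurableSpace α] {μ : Measure α} (f : Lp ℂ 2 μ) :
    ∫⁻ x, ‖f x‖ₑ ^ 2 ∂μ = ‖f‖ₑ ^ 2 := by
  rw [Lp.enorm_def, eLpNorm_eq_lintegral_rpow_enorm_toReal (by norm_num) (by norm_num)]
  simp only [ENNReal.toReal_ofNat, ENNReal.rpow_ofNat, one_div]
  rw [← ENNReal.rpow_natCast, ← ENNReal.rpow_mul]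
  norm_num

theorem lintegral_Ioc_rpow {a T : ℝ} (ha : -1 < a) (hT : 0 ≤ T) :
    ∫⁻ t in Set.Ioc 0 T, ENNReal.ofReal (t ^ a) = ENNReal.ofReal (T ^ (a + 1) / (a + 1)) := by
  rw [← ofReal_integral_eq_lintegral_ofReal
    ((intervalIntegrable_iff_integrableOn_Ioc_of_le hT).1
      (intervalIntegral.intervalIntegrable_rpow' ha))
    ((ae_restrict_iff' measurableSet_Ioc).2 (ae_of_all _ fun t ht => Real.rpow_nonneg ht.1.le _)),
    ← intervalIntegral.integral_of_le hT, integral_rpow (Or.inl ha),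
    Real.zero_rpow (by linarith), sub_zero]

/-- Weak-type bound from a frequency splitting: if the part of `u` with frequencies in `S` is bounded by
`t / 2`, then on `{t < ‖u‖}` the complementary part exceeds `t / 2`, and Chebyshev's inequality with
Plancherel's theorem bounds the measure of this set. -/
theorem measure_lt_norm_le_of_lintegral_le (u : Lp ℂ 2 (volume : Measure V)) {S : Set V}
    (hS : MeasurableSet S) {t : ℝ} (ht : 0 < t)
    (hlow : ∫⁻ ξ in S, ‖(𝓕 u : Lp ℂ 2 (volume : Measure V)) ξ‖ₑ ≤ ENNReal.ofReal (t / 2)) :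
    volume {x | t < ‖u x‖} ≤ ENNReal.ofReal (4 * t ^ (-2 : ℝ)) *
      ∫⁻ ξ in Sᶜ, ‖(𝓕 u : Lp ℂ 2 (volume : Measure V)) ξ‖ₑ ^ 2 := by
  set g : Lp ℂ 2 (volume : Measure V) := 𝓕 u with hg
  set l : Lp ℂ 2 (volume : Measure V) := ((Lp.memLp g).indicator hS).toLp _ with hl
  set h : Lp ℂ 2 (volume : Measure V) := ((Lp.memLp g).indicator hS.compl).toLp _ with hh
  have hla : l =ᵐ[volume] S.indicator g := MemLp.coeFn_toLp _
  have hha : h =ᵐ[volume] Sᶜ.indicator g := MemLp.coeFn_toLp _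
  have hsum : g = l + h := by
    ext1
    filter_upwards [hla, hha, Lp.coeFn_add l h] with x h1 h2 h3
    rw [h3, Pi.add_apply, h1, h2, Set.indicator_self_add_compl_apply]
  have hu : u = 𝓕⁻ l + 𝓕⁻ h := by
    rw [← FourierTransform.fourierInv_add, ← hsum, hg, FourierTransform.fourierInv_fourier_eq]
  have hl1 : ∫⁻ ξ, ‖l ξ‖ₑ ≤ ENNReal.ofReal (t / 2) := by
    refine le_trans (le_of_eq ?_) hlow
    rw [← lintegral_indicator hS]
    refine lintegral_congr_ae ?_
    filter_upwards [hla] with x hx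
    rw [hx, enorm_indicator_eq_indicator_enorm]
  have hh2 : ∫⁻ ξ, ‖(𝓕⁻ h : Lp ℂ 2 (volume : Measure V)) ξ‖ₑ ^ 2 = ∫⁻ ξ in Sᶜ, ‖g ξ‖ₑ ^ 2 := by
    have : ‖(𝓕⁻ h : Lp ℂ 2 (volume : Measure V))‖ₑ = ‖h‖ₑ := by
      rw [← ofReal_norm, ← ofReal_norm, ← Lp.norm_fourier_eq,
        FourierTransform.fourier_fourierInv_eq]
    rw [lintegral_enorm_sq_eq, this, ← lintegral_enorm_sq_eq, ← lintegral_indicator hS.compl]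
    refine lintegral_congr_ae ?_
    filter_upwards [hha] with x hx
    rw [hx]
    by_cases hxS : x ∈ Sᶜ <;> simp [Set.indicator, hxS]
  have hsub : volume {x | t < ‖u x‖} ≤ volume {x | ENNReal.ofReal (t ^ 2 / 4) ≤
      ‖(𝓕⁻ h : Lp ℂ 2 (volume : Measure V)) x‖ₑ ^ 2} := by
    refine measure_mono_ae ?_
    filter_upwards [fourierInv_ae_enorm_le l (hl1.trans_lt ENNReal.ofReal_lt_top),
      Lp.coeFn_add (𝓕⁻ l : Lp ℂ 2 (volume : Measure V)) (𝓕⁻ h)] with x h1 h2 h3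
    change t < ‖u x‖ at h3
    change _ ≤ _
    have h4 : ‖(𝓕⁻ l : Lp ℂ 2 (volume : Measure V)) x‖ ≤ t / 2 := by
      have := h1.trans hl1
      rwa [← ofReal_norm, ENNReal.ofReal_le_ofReal_iff (by positivity)] at this
    rw [hu, h2, Pi.add_apply] at h3
    have h5 := norm_add_le ((𝓕⁻ l : Lp ℂ 2 (volume : Measure V)) x)
      ((𝓕⁻ h : Lp ℂ 2 (volume : Measure V)) x)
    rw [← ofReal_norm, ← ENNReal.ofReal_pow (norm_nonneg _)]
    apply ENNReal.ofReal_le_ofReal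
    nlinarith
  have hcheb := mul_meas_ge_le_lintegral₀ (μ := (volume : Measure V))
    (f := fun x => ‖(𝓕⁻ h : Lp ℂ 2 (volume : Measure V)) x‖ₑ ^ 2)
    ((Lp.aestronglyMeasurable _).enorm.pow_const 2) (ENNReal.ofReal (t ^ 2 / 4))
  rw [hh2] at hcheb
  refine hsub.trans ?_
  calc _ = ENNReal.ofReal (4 * t ^ (-2 : ℝ)) * (ENNReal.ofReal (t ^ 2 / 4) *
        volume {x | ENNReal.ofReal (t ^ 2 / 4) ≤
          ‖(𝓕⁻ h : Lp ℂ 2 (volume : Measure V)) x‖ₑ ^ 2}) := by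
        rw [← mul_assoc, ← ENNReal.ofReal_mul (by positivity)]
        have : 4 * t ^ (-2 : ℝ) * (t ^ 2 / 4) = 1 := by
          rw [Real.rpow_neg ht.le, Real.rpow_ofNat]; field_simp
        rw [this, ENNReal.ofReal_one, one_mul]
    _ ≤ _ := by gcongr

/-- The part of a function with frequencies in a ball of radius `A` is bounded by `A^{d/2-σ}` times its
`Ḣ^σ` norm, stated for the Fourier transform `g`; this is Cauchy–Schwarz with weight `‖ξ‖^σ`. -/
theorem exists_lintegral_ball_enorm_le [Nontrivial V] {σ : ℝ} (hσ : 2 * σ < Module.finrank ℝ V) :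
    ∃ c : ℝ, 0 < c ∧ ∀ (g : V → ℂ), AEMeasurable g → ∀ N : ℝ, 0 ≤ N →
      ∫⁻ ξ, ENNReal.ofReal (‖ξ‖ ^ (2 * σ)) * ‖g ξ‖ₑ ^ 2 ≤ ENNReal.ofReal (N ^ 2) →
      ∀ A : ℝ, 0 < A → ∫⁻ ξ in Metric.ball (0 : V) A, ‖g ξ‖ₑ ≤
        ENNReal.ofReal (c * N * A ^ (Module.finrank ℝ V / 2 - σ)) := by
  obtain ⟨C, hC⟩ := exists_lintegral_ball_norm_rpow_le hσ
  refine ⟨√(C + 1), by positivity, fun g hgm N hN0 hN A hA => ?_⟩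
  have h1 : ∫⁻ ξ in Metric.ball (0 : V) A, ‖g ξ‖ₑ ≤ ∫⁻ ξ in Metric.ball (0 : V) A,
      ENNReal.ofReal (‖ξ‖ ^ (-σ)) * (ENNReal.ofReal (‖ξ‖ ^ σ) * ‖g ξ‖ₑ) := by
    refine lintegral_mono_ae (ae_restrict_of_ae ?_)
    filter_upwards [compl_mem_ae_iff.2 (measure_singleton (0 : V))] with ξ hξ
    have hξ : 0 < ‖ξ‖ := norm_pos_iff.2 hξ
    rw [← mul_assoc, ← ENNReal.ofReal_mul (by positivity), ← Real.rpow_add hξ]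
    simp
  refine h1.trans ((ENNReal.lintegral_mul_le_Lp_mul_Lq _ Real.HolderConjugate.two_two
    (by fun_prop) (by fun_prop)).trans ?_)
  have h2 : ∀ ξ : V, ENNReal.ofReal (‖ξ‖ ^ (-σ)) ^ (2 : ℝ) = ENNReal.ofReal (‖ξ‖ ^ (-(2 * σ))) := by
    intro ξ
    rw [ENNReal.ofReal_rpow_of_nonneg (by positivity) (by norm_num),
      ← Real.rpow_mul (norm_nonneg _)]
    ring_nf
  have h3 : ∀ ξ : V, (ENNReal.ofReal (‖ξ‖ ^ σ) * ‖g ξ‖ₑ) ^ (2 : ℝ) =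
      ENNReal.ofReal (‖ξ‖ ^ (2 * σ)) * ‖g ξ‖ₑ ^ 2 := by
    intro ξ
    rw [ENNReal.mul_rpow_of_nonneg _ _ (by norm_num),
      ENNReal.ofReal_rpow_of_nonneg (by positivity) (by norm_num),
      ← Real.rpow_mul (norm_nonneg _), ENNReal.rpow_ofNat]
    ring_nf
  simp only [h2, h3]
  have h4 : ∫⁻ ξ in Metric.ball (0 : V) A, ENNReal.ofReal (‖ξ‖ ^ (-(2 * σ))) ≤
      ENNReal.ofReal ((C + 1) * A ^ (Module.finrank ℝ V - 2 * σ)) := by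
    refine (hC A hA).trans ?_
    rw [ENNReal.ofReal_mul (by positivity)]
    gcongr
    rw [← ENNReal.ofReal_coe_nnreal]
    exact ENNReal.ofReal_le_ofReal (by linarith)
  have h5 := (setLIntegral_le_lintegral (Metric.ball (0 : V) A)
    (fun ξ => ENNReal.ofReal (‖ξ‖ ^ (2 * σ)) * ‖g ξ‖ₑ ^ 2)).trans hN
  refine (mul_le_mul' (ENNReal.rpow_le_rpow h4 (by norm_num))
    (ENNReal.rpow_le_rpow h5 (by norm_num))).trans (le_of_eq ?_)
  rw [ENNReal.ofReal_rpow_of_nonneg (by positivity) (by norm_num),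
    ENNReal.ofReal_rpow_of_nonneg (by positivity) (by norm_num),
    ← ENNReal.ofReal_mul (by positivity), Real.mul_rpow (by positivity) (by positivity),
    ← Real.sqrt_eq_rpow, ← Real.rpow_mul hA.le, ← Real.sqrt_eq_rpow (N ^ 2), Real.sqrt_sq hN0]
  ring_nf

/-- The critical Sobolev inequality `‖u‖_{L^p} ≲ ‖u‖_{Ḣ^σ}` with `p = 2d / (d - 2σ)`, following Chemin
and Xu: in the layer-cake formula for `‖u‖_{L^p}^p`, the frequencies of `u` are split at each level `t`
at the radius `A(t)` for which the low-frequency part is at most `t / 2`. -/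
theorem exists_lintegral_rpow_le_critical [Nontrivial V] {σ p : ℝ} (hσ : 0 < σ)
    (hσd : 2 * σ < Module.finrank ℝ V)
    (hp : p * (Module.finrank ℝ V - 2 * σ) = 2 * Module.finrank ℝ V) :
    ∃ C : ℝ≥0, 0 < C ∧ ∀ u : Lp ℂ 2 (volume : Measure V), ∫⁻ x, ‖u x‖ₑ ^ p ≤
      C * (∫⁻ ξ, ENNReal.ofReal (‖ξ‖ ^ (2 * σ)) *
        ‖(𝓕 u : Lp ℂ 2 (volume : Measure V)) ξ‖ₑ ^ 2) ^ (p / 2) := by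
  obtain ⟨c, hc0, hc⟩ := exists_lintegral_ball_enorm_le hσd
  set D : ℝ := ((Module.finrank ℝ V : ℕ) : ℝ) with hD
  have hp2 : 2 < p := by
    by_contra! h
    nlinarith
  set κ : ℝ := D / 2 - σ with hκ
  have hκ0 : 0 < κ := by linarith
  have hκp : κ * (p - 2) = 2 * σ := by rw [hκ]; linarith
  refine ⟨(4 * p / (p - 2) * (2 * c) ^ (p - 2)).toNNReal, Real.toNNReal_pos.2 (by
    have : 0 < p - 2 := by linarith
    positivity), fun u => ?_⟩
  set g : Lp ℂ 2 (volume : Measure V) := 𝓕 u with hg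
  set M := ∫⁻ ξ, ENNReal.ofReal (‖ξ‖ ^ (2 * σ)) * ‖g ξ‖ₑ ^ 2 with hM
  have hgm : AEMeasurable g := (Lp.aestronglyMeasurable g).aemeasurable
  rcases eq_or_ne M 0 with hM0 | hM0
  · have hg0 : g = 0 := by
      rw [hM, lintegral_eq_zero_iff' (by fun_prop)] at hM0
      ext1
      filter_upwards [hM0, compl_mem_ae_iff.2 (measure_singleton (0 : V)),
        Lp.coeFn_zero ℂ 2 (volume : Measure V)] with ξ h1 h2 h3
      have hξ : 0 < ‖ξ‖ := norm_pos_iff.2 h2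
      have : 0 < ‖ξ‖ ^ (2 * σ) := by positivity
      rw [h3]
      simpa [this.not_ge] using h1
    have hu0 : u = 0 := by
      rw [← norm_eq_zero, ← Lp.norm_fourier_eq, ← hg, hg0, norm_zero]
    have : ∫⁻ x, ‖u x‖ₑ ^ p = 0 := by
      rw [hu0]
      refine (lintegral_congr_ae ?_).trans lintegral_zero
      filter_upwards [Lp.coeFn_zero ℂ 2 (volume : Measure V)] with x hx
      simp [show 0 < p by linarith]
    rw [this]; exact zero_le
  rcases eq_or_ne M ∞ with hMt | hMt
  · rw [hMt, ENNReal.top_rpow_of_pos (by linarith), ENNReal.mul_top]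
    · exact le_top
    · have : 0 < p - 2 := by linarith
      simp only [ne_eq, ENNReal.coe_eq_zero, Real.toNNReal_eq_zero, not_le]
      positivity
  set N : ℝ := √M.toReal with hN
  have hMpos : 0 < M.toReal := ENNReal.toReal_pos hM0 hMt
  have hN0 : 0 < N := Real.sqrt_pos.2 hMpos
  have hMN : M = ENNReal.ofReal (N ^ 2) := by
    rw [hN, Real.sq_sqrt hMpos.le, ENNReal.ofReal_toReal hMt]
  set T : V → ℝ := fun ξ => 2 * c * N * ‖ξ‖ ^ κ with hT
  have hT0 : ∀ ξ, 0 ≤ T ξ := fun ξ => by positivity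
  have hTm : Measurable T := by fun_prop
  have hmeas : ∀ t : ℝ, 0 < t → volume {x | t < ‖u x‖} ≤ ENNReal.ofReal (4 * t ^ (-2 : ℝ)) *
      ∫⁻ ξ in {ξ | t ≤ T ξ}, ‖g ξ‖ₑ ^ 2 := by
    intro t ht
    -- The radius at which the bound `c N A^κ` for the low frequencies equals `t / 2`.
    set A : ℝ := (t / (2 * c * N)) ^ κ⁻¹ with hA
    have hA0 : 0 < A := by positivity
    have hAκ : A ^ κ = t / (2 * c * N) := by
      rw [hA, ← Real.rpow_mul (by positivity), inv_mul_cancel₀ hκ0.ne', Real.rpow_one]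
    have hball : (Metric.ball (0 : V) A)ᶜ = {ξ | t ≤ T ξ} := by
      ext ξ
      simp only [Set.mem_compl_iff, mem_ball_zero_iff, not_lt, Set.mem_ofPred_eq, hT]
      rw [← Real.rpow_le_rpow_iff hA0.le (norm_nonneg ξ) hκ0, hAκ, div_le_iff₀' (by positivity)]
    rw [← hball]
    refine measure_lt_norm_le_of_lintegral_le u measurableSet_ball ht ?_
    refine (hc g hgm N hN0.le hMN.le A hA0).trans (le_of_eq ?_)
    rw [hAκ]
    congr 1
    field_simp
  have hp0 : 0 < p := by linarith
  calc ∫⁻ x, ‖u x‖ₑ ^ p = ∫⁻ x, ENNReal.ofReal (‖u x‖ ^ p) := by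
        refine lintegral_congr fun x => ?_
        rw [← ofReal_norm, ENNReal.ofReal_rpow_of_nonneg (norm_nonneg _) hp0.le]
    _ = ENNReal.ofReal p * ∫⁻ t in Set.Ioi 0, volume {x | t < ‖u x‖} *
          ENNReal.ofReal (t ^ (p - 1)) :=
        lintegral_rpow_eq_lintegral_meas_lt_mul _ (ae_of_all _ fun x => norm_nonneg _)
          (Lp.aestronglyMeasurable u).norm.aemeasurable hp0
    _ ≤ ENNReal.ofReal p * ∫⁻ t in Set.Ioi (0 : ℝ), ∫⁻ ξ,
          (Set.Iic (T ξ)).indicator (fun t => ENNReal.ofReal (4 * t ^ (p - 3))) t *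
            ‖g ξ‖ₑ ^ 2 := by
        gcongr 1
        refine setLIntegral_mono' measurableSet_Ioi fun t (ht : 0 < t) => ?_
        refine (mul_le_mul_left (hmeas t ht) _).trans (le_of_eq ?_)
        rw [mul_right_comm, ← ENNReal.ofReal_mul (by positivity), mul_assoc, ← Real.rpow_add ht,
          ← lintegral_indicator (measurableSet_le measurable_const hTm),
          ← lintegral_const_mul' _ _ ENNReal.ofReal_ne_top]
        refine lintegral_congr fun ξ => ?_
        by_cases h : t ≤ T ξ
        · simp [Set.indicator, h]; ring_nf
        · simp [Set.indicator, h]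
    _ = ENNReal.ofReal p * ∫⁻ ξ, (∫⁻ t in Set.Ioi (0 : ℝ),
          (Set.Iic (T ξ)).indicator (fun t => ENNReal.ofReal (4 * t ^ (p - 3))) t) *
            ‖g ξ‖ₑ ^ 2 := by
        rw [lintegral_lintegral_swap]
        · congr 1
          refine lintegral_congr fun ξ => ?_
          rw [lintegral_mul_const'']
          exact ((Measurable.indicator (by fun_prop) measurableSet_Iic)).aemeasurable
        · refine AEMeasurable.mul ?_ ?_
          · have : Measurable fun q : ℝ × V => ({q | q.1 ≤ T q.2} : Set (ℝ × V)).indicator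
                (fun q => ENNReal.ofReal (4 * q.1 ^ (p - 3))) q :=
              Measurable.indicator (by fun_prop)
                (measurableSet_le measurable_fst (hTm.comp measurable_snd))
            exact this.aemeasurable
          · exact (hgm.comp_snd).enorm.pow_const 2
    _ = ENNReal.ofReal p * ∫⁻ ξ, ENNReal.ofReal (4 / (p - 2) * (2 * c * N) ^ (p - 2)) *
          (ENNReal.ofReal (‖ξ‖ ^ (2 * σ)) * ‖g ξ‖ₑ ^ 2) := by
        congr 1
        refine lintegral_congr fun ξ => ?_
        rw [← mul_assoc]
        congr 1
        rw [lintegral_indicator measurableSet_Iic, Measure.restrict_restrict measurableSet_Iic,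
          Set.inter_comm, Set.Ioi_inter_Iic]
        simp_rw [ENNReal.ofReal_mul (show (0 : ℝ) ≤ 4 by norm_num)]
        rw [lintegral_const_mul' _ _ ENNReal.ofReal_ne_top, lintegral_Ioc_rpow (by linarith) (hT0 ξ),
          ← ENNReal.ofReal_mul (by norm_num), ← ENNReal.ofReal_mul (by
            have : 0 < p - 2 := by linarith
            positivity)]
        congr 1
        rw [show p - 3 + 1 = p - 2 by ring, hT]
        simp only
        rw [Real.mul_rpow (by positivity) (by positivity), ← Real.rpow_mul (norm_nonneg _), hκp]
        ring
    _ = _ := by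
        rw [lintegral_const_mul' _ _ ENNReal.ofReal_ne_top, ← hM, hMN, ← mul_assoc,
          ← ENNReal.ofReal_mul hp0.le]
        change _ = ENNReal.ofReal _ * _
        have : 0 < p - 2 := by linarith
        rw [ENNReal.ofReal_rpow_of_nonneg (by positivity) (by positivity),
          ← ENNReal.ofReal_mul (by positivity), ← ENNReal.ofReal_mul (by positivity)]
        congr 1
        rw [Real.mul_rpow (by positivity) hN0.le, ← Real.rpow_natCast, ← Real.rpow_mul hN0.le]
        have h3 : N ^ (p - 2) * N ^ ((2 : ℕ) : ℝ) = N ^ (((2 : ℕ) : ℝ) * (p / 2)) := by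
          rw [← Real.rpow_add hN0]; congr 1; push_cast; ring
        rw [← h3]
        ring

end Sobolev

/-! ### The Gagliardo–Nirenberg–Sobolev inequality and its sharp constant -/

theorem eLpNorm_ofReal_rpow {α : Type*} [MeasurableSpace α] {μ : Measure α} {p : ℝ} (hp : 0 < p)
    (f : α → ℂ) : eLpNorm f (ENNReal.ofReal p) μ ^ p = ∫⁻ x, ‖f x‖ₑ ^ p ∂μ := by
  rw [eLpNorm_eq_lintegral_rpow_enorm_toReal (by simpa using hp) ENNReal.ofReal_ne_top,
    ENNReal.toReal_ofReal hp.le, ← ENNReal.rpow_mul, one_div, inv_mul_cancel₀ hp.ne',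
    ENNReal.rpow_one]

theorem homogeneous_exponent_nonneg {d : ℕ} {s p : ℝ} (hs : 0 < s) (hp : 2 < p) :
    0 ≤ (p - 2) * d / (2 * s) := by
  have : 0 < p - 2 := by linarith
  positivity

theorem mass_exponent_eq {d : ℕ} {s p : ℝ} (hs : 0 < s) :
    2 + (p - 2) / (2 * s) * (2 * s - d) = p - (p - 2) * d / (2 * s) := by
  field_simp
  ring

/-- The hypothesis on `p` says exactly that the index `σ = d/2 - d/p`, for which `p` is the critical
Sobolev exponent, is at most `s`. -/
theorem critical_index_le {d : ℕ} {s p : ℝ} (hp : 2 < p)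
    (hps : 2 * s < d → p ≤ 2 * d / (d - 2 * s)) : (d : ℝ) / 2 - d / p ≤ s := by
  have hp0 : 0 < p := by linarith
  have hd : (0 : ℝ) ≤ d := d.cast_nonneg
  rcases lt_or_ge (2 * s) (d : ℝ) with h | h
  · have := hps h
    rw [le_div_iff₀ (by linarith)] at this
    rw [sub_le_iff_le_add, ← sub_le_iff_le_add', le_div_iff₀ hp0]
    linarith
  · have : 0 ≤ (d : ℝ) / p := by positivity
    linarith

theorem mass_exponent_nonneg {d : ℕ} {s p : ℝ} (hs : 0 < s) (hp : 2 < p)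
    (hps : 2 * s < d → p ≤ 2 * d / (d - 2 * s)) :
    0 ≤ 2 + (p - 2) / (2 * s) * (2 * s - d) := by
  have hp0 : 0 < p := by linarith
  have h := critical_index_le hp hps
  rw [mass_exponent_eq hs, sub_nonneg, div_le_iff₀ (by positivity)]
  have := mul_le_mul_of_nonneg_right h hp0.le
  rw [sub_mul, div_mul_cancel₀ _ hp0.ne'] at this
  linarith

/-- Interpolation `‖u‖_{Ḣ^σ} ≤ ‖u‖_{Ḣ^s}^{σ/s} ‖u‖_{L²}^{1-σ/s}` for `0 ≤ σ ≤ s`. The factor `2π` is kept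
only on the right. -/
theorem lintegral_norm_rpow_le_interpolation {d : ℕ} {s σ : ℝ} (hs : 0 < s) (hσ : 0 ≤ σ)
    (hσs : σ ≤ s) (u : L2Rd d) :
    ∫⁻ ξ, ENNReal.ofReal (‖ξ‖ ^ (2 * σ)) * ‖(𝓕 u : L2Rd d) ξ‖ₑ ^ 2 ≤
      hsNormRd s u ^ (2 * (σ / s)) * eLpNorm u 2 volume ^ (2 * (1 - σ / s)) := by
  have hm : AEMeasurable (𝓕 u : L2Rd d) := (Lp.aestronglyMeasurable _).aemeasurable
  have h1 : 0 ≤ 1 - σ / s := by rw [sub_nonneg, div_le_one hs]; exact hσs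
  have hH := ENNReal.lintegral_mul_norm_pow_le (μ := (volume : Measure (EuclideanSpace ℝ (Fin d))))
    (f := fun ξ => ENNReal.ofReal ((2 * Real.pi * ‖ξ‖) ^ (2 * s)) * ‖(𝓕 u : L2Rd d) ξ‖ₑ ^ 2)
    (g := fun ξ => ‖(𝓕 u : L2Rd d) ξ‖ₑ ^ 2) (by fun_prop) (by fun_prop)
    (p := σ / s) (q := 1 - σ / s) (by positivity) h1 (by ring)
  have h2 : ∫⁻ ξ, ‖(𝓕 u : L2Rd d) ξ‖ₑ ^ 2 = eLpNorm u 2 volume ^ 2 := by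
    rw [lintegral_enorm_sq_eq, ← ofReal_norm, Lp.norm_fourier_eq, ofReal_norm, Lp.enorm_def]
  refine (lintegral_mono fun ξ => ?_).trans (hH.trans (le_of_eq ?_))
  · rw [ENNReal.mul_rpow_of_nonneg _ _ (by positivity), mul_assoc,
      ← ENNReal.rpow_add_of_nonneg _ _ (by positivity) h1,
      ENNReal.ofReal_rpow_of_nonneg (by positivity) (by positivity),
      ← Real.rpow_mul (by positivity)]
    rw [show σ / s + (1 - σ / s) = 1 by ring, ENNReal.rpow_one,
      show 2 * s * (σ / s) = 2 * σ by field_simp]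
    gcongr
    have := Real.pi_gt_three
    nlinarith [norm_nonneg ξ]
  · rw [h2, hsNormRd, ← ENNReal.rpow_mul, ← ENNReal.rpow_natCast, ← ENNReal.rpow_mul]
    congr 2
    ring

/-- The Gagliardo–Nirenberg–Sobolev inequality with some constant: the critical Sobolev inequality of
index `σ = d/2 - d/p`, interpolated between `L²` and `Ḣ^s`. -/
theorem exists_gagliardo_nirenberg {d : ℕ} (hd : 1 ≤ d) {s p : ℝ} (hs : 0 < s) (hp : 2 < p)
    (hps : 2 * s < d → p ≤ 2 * d / (d - 2 * s)) :
    ∃ K : ℝ≥0, 0 < K ∧ ∀ u : L2Rd d, eLpNorm u (ENNReal.ofReal p) volume ^ p ≤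
      K * (hsNormRd s u ^ ((p - 2) * d / (2 * s)) *
        eLpNorm u 2 volume ^ (2 + (p - 2) / (2 * s) * (2 * s - d))) := by
  have hp0 : 0 < p := by linarith
  have hd0 : (0 : ℝ) < d := by exact_mod_cast hd
  have : NeZero d := ⟨by omega⟩
  set σ : ℝ := d / 2 - d / p with hσ
  have hσ0 : 0 < σ := by
    rw [hσ, sub_pos]
    gcongr
  have hσs : σ ≤ s := critical_index_le hp hps
  have hfr : (Module.finrank ℝ (EuclideanSpace ℝ (Fin d)) : ℝ) = d := by simp
  obtain ⟨K, hK, h⟩ := exists_lintegral_rpow_le_critical (V := EuclideanSpace ℝ (Fin d)) (σ := σ)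
    (p := p) hσ0 (by rw [hfr, hσ]; have : 0 < d / p := by positivity
                     linarith) (by rw [hfr, hσ]; field_simp; ring)
  refine ⟨K, hK, fun u => ?_⟩
  rw [eLpNorm_ofReal_rpow hp0]
  refine (h u).trans ?_
  gcongr
  refine (ENNReal.rpow_le_rpow (lintegral_norm_rpow_le_interpolation hs hσ0.le hσs u)
    (by positivity)).trans (le_of_eq ?_)
  rw [ENNReal.mul_rpow_of_nonneg _ _ (by positivity), ← ENNReal.rpow_mul, ← ENNReal.rpow_mul,
    mass_exponent_eq hs]
  congr 2
  · rw [hσ]; field_simp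
  · rw [hσ]; field_simp

theorem hsNormRd_lt_top {d : ℕ} {s : ℝ} (hs : 0 < s) {u : L2Rd d} (hu : MemHsRd s u) :
    hsNormRd s u < ∞ := by
  refine ENNReal.rpow_lt_top_of_nonneg (by norm_num) (ne_of_lt (lt_of_le_of_lt ?_ hu))
  refine lintegral_mono fun ξ => ?_
  gcongr
  rw [Real.rpow_mul (by positivity)]
  gcongr
  rw [Real.rpow_ofNat]
  linarith

/-- Finiteness of the numerator of `quotientJ`, which excludes the junk value `∞ / ∞ = 0`. -/
theorem gagliardo_nirenberg_numerator_lt_top {d : ℕ} {s p : ℝ} (hs : 0 < s) (hp : 2 < p)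
    (hps : 2 * s < d → p ≤ 2 * d / (d - 2 * s)) {u : L2Rd d} (hu : MemHsRd s u) :
    hsNormRd s u ^ ((p - 2) * d / (2 * s)) *
      eLpNorm u 2 volume ^ (2 + (p - 2) / (2 * s) * (2 * s - d)) < ∞ :=
  ENNReal.mul_lt_top (ENNReal.rpow_lt_top_of_nonneg (homogeneous_exponent_nonneg hs hp)
    (hsNormRd_lt_top hs hu).ne) (ENNReal.rpow_lt_top_of_nonneg (mass_exponent_nonneg hs hp hps)
    (Lp.eLpNorm_ne_top u))

theorem eLpNorm_ofReal_rpow_eq_zero_iff {d : ℕ} {p : ℝ} (hp : 0 < p) (u : L2Rd d) :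
    eLpNorm u (ENNReal.ofReal p) volume ^ p = 0 ↔ u = 0 := by
  rw [ENNReal.rpow_eq_zero_iff_of_pos hp, eLpNorm_eq_zero_iff (Lp.aestronglyMeasurable u)
    (by simpa using hp), ← Lp.eq_zero_iff_ae_eq_zero]

theorem sharpConst_lt_top {d : ℕ} (hd : 1 ≤ d) {s p : ℝ} (hs : 0 < s) (hp : 2 < p)
    (hps : 2 * s < d → p ≤ 2 * d / (d - 2 * s)) : sharpConst d p s < ∞ := by
  obtain ⟨K, hK, h⟩ := exists_gagliardo_nirenberg hd hs hp hps
  have hK' : (K : ℝ≥0∞) ≠ 0 := by exact_mod_cast hK.ne'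
  rw [sharpConst, ENNReal.inv_lt_top]
  refine lt_of_lt_of_le (b := (K : ℝ≥0∞)⁻¹) (by simp) ?_
  refine le_iInf fun u => le_iInf fun hu => le_iInf fun hu0 => ?_
  have hP : eLpNorm u (ENNReal.ofReal p) volume ^ p ≠ 0 :=
    (eLpNorm_ofReal_rpow_eq_zero_iff (by linarith) u).not.2 hu0
  rw [quotientJ, ENNReal.le_div_iff_mul_le (Or.inl hP)
    (Or.inr (gagliardo_nirenberg_numerator_lt_top hs hp hps hu).ne)]
  calc _ ≤ (K : ℝ≥0∞)⁻¹ * (K * _) := by gcongr; exact h u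
    _ = _ := by rw [← mul_assoc, ENNReal.inv_mul_cancel hK' (by simp), one_mul]

theorem sharpConst_pos {d : ℕ} {s p : ℝ} (hs : 0 < s) (hp : 2 < p)
    (hps : 2 * s < d → p ≤ 2 * d / (d - 2 * s)) {u : L2Rd d} (hu : MemHsRd s u) (hu0 : u ≠ 0) :
    0 < sharpConst d p s := by
  rw [sharpConst, ENNReal.inv_pos]
  refine ne_top_of_le_ne_top ?_ (iInf₂_le_of_le u hu (iInf_le _ hu0))
  exact ENNReal.div_ne_top (gagliardo_nirenberg_numerator_lt_top hs hp hps hu).ne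
    ((eLpNorm_ofReal_rpow_eq_zero_iff (by linarith) u).not.2 hu0)

theorem eLpNorm_rpow_le_sharpConst {d : ℕ} (hd : 1 ≤ d) {s p : ℝ} (hs : 0 < s) (hp : 2 < p)
    (hps : 2 * s < d → p ≤ 2 * d / (d - 2 * s)) {u : L2Rd d} (hu : MemHsRd s u) :
    eLpNorm u (ENNReal.ofReal p) volume ^ p ≤
      sharpConst d p s * (hsNormRd s u ^ ((p - 2) * d / (2 * s)) *
        eLpNorm u 2 volume ^ (2 + (p - 2) / (2 * s) * (2 * s - d))) := by
  by_cases hu0 : u = 0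
  · rw [(eLpNorm_ofReal_rpow_eq_zero_iff (by linarith) u).2 hu0]
    exact zero_le
  have h1 : (sharpConst d p s)⁻¹ ≤ quotientJ d p s u := by
    rw [sharpConst, inv_inv]
    exact iInf₂_le_of_le u hu (iInf_le _ hu0)
  have h3 := ENNReal.mul_le_of_le_div h1
  rwa [← ENNReal.div_eq_inv_mul, ENNReal.div_le_iff (sharpConst_pos hs hp hps hu hu0).ne'
    (sharpConst_lt_top hd hs hp hps).ne, mul_comm] at h3

/-! ### Schwartz functions -/

theorem exists_schwartz_norm_le {V : Type*} [NormedAddCommGroup V] [NormedSpace ℝ V]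
    (f : SchwartzMap V ℂ) (r : ℝ) :
    ∃ C : ℝ, 0 < C ∧ ∀ x, ‖f x‖ ≤ C * (1 + ‖x‖) ^ (-r) := by
  obtain ⟨k, hk⟩ := exists_nat_ge r
  obtain ⟨C, hC⟩ : ∃ C : ℝ, ∀ x, (1 + ‖x‖) ^ k * ‖f x‖ ≤ C := by
    refine ⟨2 ^ k * ((Finset.Iic (k, 0)).sup fun m => SchwartzMap.seminorm ℝ m.1 m.2) f,
      fun x => ?_⟩
    have := SchwartzMap.one_add_le_sup_seminorm_apply (𝕜 := ℝ) (m := (k, 0)) le_rfl le_rfl f x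
    simpa only [norm_iteratedFDeriv_zero] using this
  refine ⟨max C 1, by positivity, fun x => ?_⟩
  have h1 : 0 < 1 + ‖x‖ := by positivity
  have h2 : (1 + ‖x‖) ^ r ≤ (1 + ‖x‖) ^ k := by
    rw [← Real.rpow_natCast]
    exact Real.rpow_le_rpow_of_exponent_le (by linarith [norm_nonneg x]) hk
  rw [Real.rpow_neg h1.le, ← div_eq_mul_inv, le_div_iff₀ (by positivity), mul_comm]
  calc _ ≤ (1 + ‖x‖) ^ k * ‖f x‖ := by gcongr
    _ ≤ _ := (hC x).trans (le_max_left _ _)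

theorem memHsRd_schwartz {d : ℕ} {s : ℝ} (hs : 0 < s)
    (f : SchwartzMap (EuclideanSpace ℝ (Fin d)) ℂ) : MemHsRd s (f.toLp 2) := by
  obtain ⟨C, hC, h⟩ := exists_schwartz_norm_le (𝓕 f) (s + d + 1)
  have hint := (integrable_one_add_norm (E := EuclideanSpace ℝ (Fin d)) (μ := volume)
    (r := 2 * d + 2) (by
      simp only [finrank_euclideanSpace, Fintype.card_fin]
      have : (0 : ℝ) ≤ d := d.cast_nonneg
      linarith)).const_mul ((2 * Real.pi) ^ (2 * s) * C ^ 2)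
  rw [MemHsRd]
  refine lt_of_le_of_lt (lintegral_mono_ae ?_) hint.lintegral_lt_top
  rw [SchwartzMap.toLp_fourier_eq]
  filter_upwards [(𝓕 f).coeFn_toLp 2 volume] with ξ hξ
  rw [hξ, ← ofReal_norm, ← ENNReal.ofReal_pow (norm_nonneg _), ← ENNReal.ofReal_mul (by positivity)]
  apply ENNReal.ofReal_le_ofReal
  have h1 : 0 < 1 + ‖ξ‖ := by positivity
  have hpi := Real.pi_gt_three
  calc (1 + (2 * Real.pi * ‖ξ‖) ^ 2) ^ s * ‖(𝓕 f) ξ‖ ^ 2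
      ≤ ((2 * Real.pi * (1 + ‖ξ‖)) ^ 2) ^ s * (C * (1 + ‖ξ‖) ^ (-(s + d + 1))) ^ 2 := by
        gcongr
        · have : 0 ≤ (2 * Real.pi) ^ 2 * ‖ξ‖ := by positivity
          nlinarith
        · exact h ξ
    _ = _ := by
        rw [← Real.rpow_natCast (2 * Real.pi * (1 + ‖ξ‖)), ← Real.rpow_mul (by positivity),
          Real.mul_rpow (by positivity) h1.le, mul_pow,
          ← Real.rpow_natCast ((1 + ‖ξ‖) ^ (-(s + d + 1))), ← Real.rpow_mul h1.le]
        have : (1 + ‖ξ‖) ^ (-(2 * (d : ℝ) + 2)) = (1 + ‖ξ‖) ^ (((2 : ℕ) : ℝ) * s) *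
          (1 + ‖ξ‖) ^ (-(s + d + 1) * ((2 : ℕ) : ℝ)) := by
          rw [← Real.rpow_add h1]; congr 1; push_cast; ring
        rw [this]
        push_cast
        ring

/-! ### Lattice sums -/

theorem exists_sum_int_le : ∃ S : ℝ, 0 < S ∧ ∀ (t : ℝ) (F : Finset ℤ),
    ∑ k ∈ F, ((1 + |t - k|) ^ 2)⁻¹ ≤ S := by
  have hsum : Summable fun j : ℤ => 4 * ((1 + |(j : ℝ)|) ^ 2)⁻¹ := by
    refine Summable.mul_left _ ?_
    refine Summable.of_norm_bounded_eventually (Real.summable_one_div_int_pow.2 one_lt_two) ?_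
    refine (Set.finite_singleton (0 : ℤ)).subset fun j hj => ?_
    by_contra hj0
    refine hj ?_
    have h0 : 0 < |(j : ℝ)| := abs_pos.2 (by exact_mod_cast hj0)
    change ‖((1 + |(j : ℝ)|) ^ 2)⁻¹‖ ≤ 1 / (j : ℝ) ^ 2
    rw [Real.norm_of_nonneg (by positivity), ← sq_abs (j : ℝ), one_div]
    gcongr
    linarith
  refine ⟨∑' j : ℤ, 4 * ((1 + |(j : ℝ)|) ^ 2)⁻¹ + 1, by positivity, fun t F => ?_⟩
  have h1 : ∀ k : ℤ, ((1 + |t - k|) ^ 2)⁻¹ ≤ 4 * ((1 + |((k - ⌊t⌋ : ℤ) : ℝ)|) ^ 2)⁻¹ := by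
    intro k
    have h2 : 1 + |((k - ⌊t⌋ : ℤ) : ℝ)| ≤ 2 * (1 + |t - k|) := by
      have h3 : |((k - ⌊t⌋ : ℤ) : ℝ)| ≤ |t - k| + 1 := by
        push_cast
        have h4 := Int.floor_le t
        have h5 := Int.lt_floor_add_one t
        rcases abs_cases ((k : ℝ) - ⌊t⌋) with h | h <;> rcases abs_cases (t - k) with h' | h' <;>
          linarith
      linarith [abs_nonneg (t - k)]
    rw [← div_eq_mul_inv, le_div_iff₀ (by positivity), inv_mul_le_iff₀ (by positivity)]
    calc _ ≤ (2 * (1 + |t - k|)) ^ 2 := by gcongr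
      _ = _ := by ring
  calc _ ≤ ∑ k ∈ F, 4 * ((1 + |((k - ⌊t⌋ : ℤ) : ℝ)|) ^ 2)⁻¹ := Finset.sum_le_sum fun k _ => h1 k
    _ = ∑ j ∈ F.image (fun k => k - ⌊t⌋), 4 * ((1 + |(j : ℝ)|) ^ 2)⁻¹ := by
        rw [Finset.sum_image]
        intro a _ b _ h
        simpa using h
    _ ≤ ∑' j : ℤ, 4 * ((1 + |(j : ℝ)|) ^ 2)⁻¹ :=
        hsum.sum_le_tsum _ fun j _ => by positivity
    _ ≤ _ := by linarith

/-- The frequency `n ∈ ℤᵈ` as a point of `ℝᵈ`. -/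
def freq {d : ℕ} (n : Fin d → ℤ) : EuclideanSpace ℝ (Fin d) := WithLp.toLp 2 fun i => (n i : ℝ)

@[simp] theorem freq_apply {d : ℕ} (n : Fin d → ℤ) (i : Fin d) : freq n i = n i := rfl

theorem norm_freq {d : ℕ} (n : Fin d → ℤ) : ‖freq n‖ = freqNorm n := by
  simp [EuclideanSpace.norm_eq, freqNorm]

/-- Sums of `(1 + ‖ξ - n‖)^{-2d}` over the lattice are bounded uniformly in `ξ`: the summand is
dominated by a product of one-dimensional ones. -/
theorem exists_sum_lattice_le (d : ℕ) : ∃ S : ℝ, 0 < S ∧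
    ∀ (ξ : EuclideanSpace ℝ (Fin d)) (F : Finset (Fin d → ℤ)),
      ∑ n ∈ F, (1 + ‖ξ - freq n‖) ^ (-(2 * d : ℝ)) ≤ S := by
  classical
  obtain ⟨S, hS, h⟩ := exists_sum_int_le
  refine ⟨S ^ d, by positivity, fun ξ F => ?_⟩
  have h1 : ∀ n : Fin d → ℤ, (1 + ‖ξ - freq n‖) ^ (-(2 * d : ℝ)) ≤
      ∏ i, ((1 + |ξ i - n i|) ^ 2)⁻¹ := by
    intro n
    rw [Real.rpow_neg (by positivity), Finset.prod_inv_distrib]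
    gcongr
    calc ∏ i, (1 + |ξ i - n i|) ^ 2 ≤ ∏ _i : Fin d, (1 + ‖ξ - freq n‖) ^ 2 := by
          refine Finset.prod_le_prod (fun i _ => by positivity) fun i _ => ?_
          gcongr
          exact PiLp.norm_apply_le (ξ - freq n) i
      _ = _ := by
          rw [Finset.prod_const, Finset.card_univ, Fintype.card_fin, ← pow_mul,
            ← Real.rpow_natCast]
          push_cast
          rfl
  have hsub : F ⊆ Fintype.piFinset fun i => F.image fun n => n i := fun n hn =>
    Fintype.mem_piFinset.2 fun i => Finset.mem_image_of_mem (fun n : Fin d → ℤ => n i) hn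
  calc _ ≤ ∑ n ∈ F, ∏ i, ((1 + |ξ i - n i|) ^ 2)⁻¹ := Finset.sum_le_sum fun n _ => h1 n
    _ ≤ ∑ n ∈ Fintype.piFinset fun i => F.image fun n => n i, ∏ i, ((1 + |ξ i - n i|) ^ 2)⁻¹ :=
        Finset.sum_le_sum_of_subset_of_nonneg hsub fun n _ _ =>
          Finset.prod_nonneg fun i _ => by positivity
    _ = ∏ i, ∑ k ∈ F.image (fun n => n i), ((1 + |ξ i - k|) ^ 2)⁻¹ :=
        (Finset.prod_univ_sum (fun i => F.image fun n => n i)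
          (fun i (k : ℤ) => ((1 + |ξ i - k|) ^ 2)⁻¹)).symm
    _ ≤ ∏ _i : Fin d, S :=
        Finset.prod_le_prod (fun i _ => Finset.sum_nonneg fun k _ => by positivity)
          fun i _ => h _ _
    _ = S ^ d := by simp

theorem eLpNorm_two_le_of_lintegral_le {α E : Type*} [MeasurableSpace α] {μ : Measure α}
    [NormedAddCommGroup E]
    {f : α → E} {R : ℝ} (hR : 0 ≤ R) (h : ∫⁻ x, ‖f x‖ₑ ^ 2 ∂μ ≤ ENNReal.ofReal (R ^ 2)) :
    eLpNorm f 2 μ ≤ ENNReal.ofReal R := by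
  rw [eLpNorm_eq_lintegral_rpow_enorm_toReal (by norm_num) (by norm_num)]
  simp only [ENNReal.toReal_ofNat, ENNReal.rpow_ofNat]
  refine (ENNReal.rpow_le_rpow h (by norm_num)).trans (le_of_eq ?_)
  rw [ENNReal.ofReal_rpow_of_nonneg (by positivity) (by norm_num), ← Real.sqrt_eq_rpow,
    Real.sqrt_sq hR]

/-- A discrete-to-continuous Young inequality: `b ↦ ∑ₙ K(· - n) bₙ` is bounded from `ℓ²` to `L²` when
`K` decays fast enough. This is Schur's test. -/
theorem exists_eLpNorm_sum_translates_le {d : ℕ} (hd : 1 ≤ d)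
    {K : EuclideanSpace ℝ (Fin d) → ℝ} (hKm : Measurable K) (hK0 : ∀ ξ, 0 ≤ K ξ)
    {C : ℝ} (hC : 0 ≤ C) (hK : ∀ ξ, K ξ ≤ C * (1 + ‖ξ‖) ^ (-(2 * d : ℝ))) :
    ∃ M : ℝ, 0 ≤ M ∧ ∀ (F : Finset (Fin d → ℤ)) (b : (Fin d → ℤ) → ℝ),
      eLpNorm (fun ξ => ∑ n ∈ F, K (ξ - freq n) * b n) 2 volume ≤
        ENNReal.ofReal (M * √(∑ n ∈ F, b n ^ 2)) := by
  obtain ⟨S, hS, hsum⟩ := exists_sum_lattice_le d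
  have hKi : Integrable K := by
    have hd0 : (1 : ℝ) ≤ d := by exact_mod_cast hd
    refine ((integrable_one_add_norm (E := EuclideanSpace ℝ (Fin d)) (μ := volume)
      (r := 2 * d) (by simp only [finrank_euclideanSpace, Fintype.card_fin]; linarith)).const_mul
      C).mono' hKm.aestronglyMeasurable (ae_of_all _ fun ξ => ?_)
    rw [Real.norm_of_nonneg (hK0 ξ)]
    exact hK ξ
  refine ⟨√(C * S * ∫ ξ, K ξ), by positivity, fun F b => ?_⟩
  have hI : 0 ≤ ∫ ξ, K ξ := integral_nonneg hK0
  have hb : 0 ≤ ∑ n ∈ F, b n ^ 2 := Finset.sum_nonneg fun n _ => by positivity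
  refine eLpNorm_two_le_of_lintegral_le (by positivity) ?_
  rw [mul_pow, Real.sq_sqrt (by positivity), Real.sq_sqrt hb]
  have hpt : ∀ ξ, ‖∑ n ∈ F, K (ξ - freq n) * b n‖ₑ ^ 2 ≤
      ENNReal.ofReal (C * S * ∑ n ∈ F, b n ^ 2 * K (ξ - freq n)) := by
    intro ξ
    rw [← ofReal_norm, ← ENNReal.ofReal_pow (norm_nonneg _), Real.norm_eq_abs, sq_abs]
    apply ENNReal.ofReal_le_ofReal
    refine (Finset.sum_sq_le_sum_mul_sum_of_sq_le_mul F (f := fun n => K (ξ - freq n))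
      (g := fun n => b n ^ 2 * K (ξ - freq n)) (fun n _ => hK0 _)
      (fun n _ => mul_nonneg (sq_nonneg _) (hK0 _)) (fun n _ => by ring_nf; rfl)).trans ?_
    gcongr
    · exact Finset.sum_nonneg fun n _ => mul_nonneg (sq_nonneg _) (hK0 _)
    · calc _ ≤ ∑ n ∈ F, C * (1 + ‖ξ - freq n‖) ^ (-(2 * d : ℝ)) :=
            Finset.sum_le_sum fun n _ => hK _
        _ ≤ _ := by rw [← Finset.mul_sum]; gcongr; exact hsum ξ F
  have hint : Integrable fun ξ => C * S * ∑ n ∈ F, b n ^ 2 * K (ξ - freq n) :=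
    (integrable_finsetSum F fun n _ => (hKi.comp_sub_right (freq n)).const_mul _).const_mul _
  refine (lintegral_mono hpt).trans (le_of_eq ?_)
  rw [← ofReal_integral_eq_lintegral_ofReal hint (ae_of_all _ fun ξ => mul_nonneg (by positivity)
    (Finset.sum_nonneg fun n _ => mul_nonneg (sq_nonneg _) (hK0 _))), integral_const_mul,
    integral_finsetSum _ fun n _ => (hKi.comp_sub_right (freq n)).const_mul _]
  simp_rw [integral_const_mul, integral_sub_right_eq_self K, ← Finset.sum_mul]
  congr 1
  ring

/-! ### Elementary power inequalities -/

theorem exists_add_rpow_le {s ε : ℝ} (hs : 0 ≤ s) (hε : 0 < ε) :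
    ∃ C : ℝ, 0 < C ∧ ∀ a b : ℝ, 0 ≤ a → 0 ≤ b → (a + b) ^ s ≤ (1 + ε) * a ^ s + C * b ^ s := by
  have hcont : Filter.Tendsto (fun η : ℝ => (1 + η) ^ s) (nhdsWithin 0 (Set.Ioi 0)) (nhds 1) := by
    have : ContinuousAt (fun η : ℝ => (1 + η) ^ s) 0 :=
      ContinuousAt.rpow_const (by fun_prop) (Or.inl (by norm_num))
    have h := this.tendsto
    simp only [add_zero, Real.one_rpow] at h
    exact h.mono_left nhdsWithin_le_nhds
  obtain ⟨η, hη1, hη0⟩ := ((hcont.eventually (ge_mem_nhds (show (1 : ℝ) < 1 + ε by linarith))).and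
    self_mem_nhdsWithin).exists
  have hη0 : 0 < η := hη0
  refine ⟨(1 + η⁻¹) ^ s, by positivity, fun a b ha hb => ?_⟩
  rcases le_total b (η * a) with h | h
  · calc (a + b) ^ s ≤ ((1 + η) * a) ^ s := by gcongr; linarith
      _ = (1 + η) ^ s * a ^ s := Real.mul_rpow (by positivity) ha
      _ ≤ (1 + ε) * a ^ s := by gcongr
      _ ≤ _ := le_add_of_nonneg_right (by positivity)
  · have h' : a ≤ η⁻¹ * b := by rwa [le_inv_mul_iff₀ hη0]
    calc (a + b) ^ s ≤ ((1 + η⁻¹) * b) ^ s := by gcongr; linarith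
      _ = (1 + η⁻¹) ^ s * b ^ s := Real.mul_rpow (by positivity) hb
      _ ≤ _ := le_add_of_nonneg_left (by positivity)

/-- The symbol estimate behind the commutator bound: the difference of two powers is a small multiple of
one of them plus a large multiple of the power of the distance. -/
theorem exists_abs_rpow_sub_rpow_le {s ε : ℝ} (hs : 0 ≤ s) (hε : 0 < ε) :
    ∃ C : ℝ, 0 < C ∧ ∀ x y t : ℝ, 0 ≤ x → 0 ≤ y → |x - y| ≤ t →
      |x ^ s - y ^ s| ≤ ε * y ^ s + C * t ^ s := by
  set δ : ℝ := min 1 (ε / 2) with hδ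
  have hδ0 : 0 < δ := by positivity
  have hδ1 : δ ≤ 1 := min_le_left _ _
  have hδ2 : δ ≤ ε / 2 := min_le_right _ _
  obtain ⟨C, hC, h⟩ := exists_add_rpow_le hs hδ0
  refine ⟨2 * C, by positivity, fun x y t hx hy ht => ?_⟩
  have ht0 : 0 ≤ t := (abs_nonneg _).trans ht
  have hxy := abs_le.1 ht
  have h1 : x ^ s ≤ (1 + δ) * y ^ s + C * t ^ s :=
    (Real.rpow_le_rpow hx (by linarith) hs).trans (h y t hy ht0)
  have h2 : y ^ s ≤ (1 + δ) * x ^ s + C * t ^ s :=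
    (Real.rpow_le_rpow hy (by linarith) hs).trans (h x t hx ht0)
  have hys : 0 ≤ y ^ s := by positivity
  have hts : 0 ≤ C * t ^ s := by positivity
  have hxs : 0 ≤ δ ^ 2 * x ^ s := by positivity
  have h3 : δ * y ^ s ≤ ε / 2 * y ^ s := by gcongr
  have h4 : (1 - δ) * y ^ s ≤ (1 - δ) * ((1 + δ) * x ^ s + C * t ^ s) :=
    mul_le_mul_of_nonneg_left h2 (by linarith)
  have h5 : 0 ≤ δ * (C * t ^ s) := by positivity
  have h6 : 0 ≤ ε * y ^ s := by positivity
  rw [abs_le]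
  constructor <;> linarith

/-! ### Localized trigonometric polynomials -/

/-- The covering map `ℝᵈ → 𝕋ᵈ`. -/
def toTorus {d : ℕ} (x : EuclideanSpace ℝ (Fin d)) : UnitAddTorus (Fin d) :=
  fun i => (x i : UnitAddCircle)

/-- The trigonometric polynomial `∑_{n ∈ F} cₙ e^{2πi n·y}` on `𝕋ᵈ`. -/
def torusPoly {d : ℕ} (F : Finset (Fin d → ℤ)) (c : (Fin d → ℤ) → ℂ) (y : UnitAddTorus (Fin d)) :
    ℂ :=
  ∑ n ∈ F, c n * UnitAddTorus.mFourier n y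

theorem mFourier_toTorus {d : ℕ} (n : Fin d → ℤ) (x : EuclideanSpace ℝ (Fin d)) :
    UnitAddTorus.mFourier n (toTorus x) = Real.fourierChar (inner ℝ x (freq n)) := by
  simp only [UnitAddTorus.mFourier, ContinuousMap.coe_mk, toTorus, fourier_coe_apply,
    Real.fourierChar_apply, ← Complex.exp_sum]
  congr 1
  simp only [PiLp.inner_apply, freq_apply, RCLike.inner_apply, conj_trivial, Complex.ofReal_one,
    div_one]
  push_cast
  rw [Finset.mul_sum, Finset.sum_mul]
  refine Finset.sum_congr rfl fun i _ => ?_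
  ring

theorem contDiff_torusPoly_toTorus {d : ℕ} (F : Finset (Fin d → ℤ)) (c : (Fin d → ℤ) → ℂ) :
    ContDiff ℝ (⊤ : ℕ∞) fun x : EuclideanSpace ℝ (Fin d) => torusPoly F c (toTorus x) := by
  simp only [torusPoly, mFourier_toTorus, Real.fourierChar_apply]
  refine ContDiff.sum fun n _ => contDiff_const.mul (ContDiff.cexp (ContDiff.mul ?_ contDiff_const))
  exact Complex.ofRealCLM.contDiff.comp
    (contDiff_const.mul (contDiff_id.inner ℝ contDiff_const))

theorem fourier_torusPoly_mul {d : ℕ} (F : Finset (Fin d → ℤ)) (c : (Fin d → ℤ) → ℂ)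
    {Φ : EuclideanSpace ℝ (Fin d) → ℂ} (hΦ : Integrable Φ) (ξ : EuclideanSpace ℝ (Fin d)) :
    𝓕 (fun x => torusPoly F c (toTorus x) * Φ x) ξ = ∑ n ∈ F, c n * 𝓕 Φ (ξ - freq n) := by
  simp only [Real.fourier_eq, torusPoly, Finset.sum_mul, Finset.smul_sum, mFourier_toTorus]
  have h : ∀ n (x : EuclideanSpace ℝ (Fin d)), Real.fourierChar (-inner ℝ x ξ) •
      (c n * Real.fourierChar (inner ℝ x (freq n)) * Φ x) =
      c n * (Real.fourierChar (-inner ℝ x (ξ - freq n)) • Φ x) := by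
    intro n x
    rw [inner_sub_right, neg_sub, sub_eq_add_neg, AddChar.map_add_eq_mul]
    simp only [Circle.smul_def, smul_eq_mul, Circle.coe_mul]
    ring
  simp_rw [h]
  rw [integral_finsetSum]
  · simp_rw [integral_const_mul]
  · exact fun n _ => ((Real.fourierIntegral_convergent_iff (ξ - freq n)).2 hΦ).const_mul _

/-- The product on `ℝᵈ` of a smooth compactly supported cutoff `φ` with the periodic lift of a
trigonometric polynomial, as a Schwartz function. -/
def cutoffPoly {d : ℕ} {φ : EuclideanSpace ℝ (Fin d) → ℝ} (hφ : ContDiff ℝ (⊤ : ℕ∞) φ)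
    (hφc : HasCompactSupport φ) (F : Finset (Fin d → ℤ)) (c : (Fin d → ℤ) → ℂ) :
    SchwartzMap (EuclideanSpace ℝ (Fin d)) ℂ :=
  HasCompactSupport.toSchwartzMap (f := fun x => torusPoly F c (toTorus x) * (φ x : ℂ))
    ((hφc.comp_left (g := fun t : ℝ => (t : ℂ)) Complex.ofReal_zero).mul_left)
    ((contDiff_torusPoly_toTorus F c).mul (Complex.ofRealCLM.contDiff.comp hφ))

theorem cutoffPoly_apply {d : ℕ} {φ : EuclideanSpace ℝ (Fin d) → ℝ} (hφ : ContDiff ℝ (⊤ : ℕ∞) φ)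
    (hφc : HasCompactSupport φ) (F : Finset (Fin d → ℤ)) (c : (Fin d → ℤ) → ℂ)
    (x : EuclideanSpace ℝ (Fin d)) :
    cutoffPoly hφ hφc F c x = torusPoly F c (toTorus x) * (φ x : ℂ) := rfl

/-! ### Integration over the torus -/

/-- The half-open unit cube, a fundamental domain for `ℤᵈ` in `ℝᵈ`. -/
def unitCube (d : ℕ) : Set (EuclideanSpace ℝ (Fin d)) := {x | ∀ i, x i ∈ Set.Ioc (0 : ℝ) 1}

theorem measurable_toTorus {d : ℕ} : Measurable (toTorus (d := d)) :=
  measurable_pi_lambda _ fun i => AddCircle.measurable_mk'.comp (by fun_prop)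

theorem lintegral_torus_eq {d : ℕ} (f : UnitAddTorus (Fin d) → ℝ≥0∞) :
    ∫⁻ y, f y ∂torusMeasure d = ∫⁻ x in unitCube d, f (toTorus x) := by
  have h := UnitAddTorus.lintegral_preimage f (fun _ : Fin d => (0 : ℝ))
  simp only [zero_add] at h
  refine Eq.trans h ?_
  have hp := EuclideanSpace.volume_preserving_symm_measurableEquiv_toLp (Fin d)
  have h2 := hp.symm.setLIntegral_comp_preimage_emb (MeasurableEquiv.measurableEmbedding _)
    (fun x => f (toTorus x)) (unitCube d)
  rw [← h2]
  rfl

/-- A trigonometric polynomial as an element of `L²(𝕋ᵈ)`. -/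
def torusPolyLp {d : ℕ} (F : Finset (Fin d → ℤ)) (c : (Fin d → ℤ) → ℂ) : L2Td d :=
  ∑ n ∈ F, c n • (UnitAddTorus.mFourierLp 2 n : L2Td d)

theorem coeFn_torusPolyLp {d : ℕ} (F : Finset (Fin d → ℤ)) (c : (Fin d → ℤ) → ℂ) :
    torusPolyLp F c =ᵐ[torusMeasure d] torusPoly F c := by
  have h1 : ∀ n ∈ F, ∀ᵐ y ∂torusMeasure d, (c n • (UnitAddTorus.mFourierLp 2 n : L2Td d)) y =
      c n * UnitAddTorus.mFourier n y := by
    intro n _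
    filter_upwards [Lp.coeFn_smul (c n) (UnitAddTorus.mFourierLp 2 n : L2Td d),
      UnitAddTorus.coeFn_mFourierLp 2 n] with y hy hy'
    rw [hy, Pi.smul_apply, hy', smul_eq_mul]
  filter_upwards [Lp.coeFn_finsetSum F fun n => c n • (UnitAddTorus.mFourierLp 2 n : L2Td d),
    (Finset.eventually_all F).2 h1] with y hy hy'
  rw [torusPolyLp, hy, Finset.sum_apply]
  exact Finset.sum_congr rfl hy'

theorem norm_sq_torusPolyLp {d : ℕ} (F : Finset (Fin d → ℤ)) (c : (Fin d → ℤ) → ℂ) :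
    ‖torusPolyLp F c‖ ^ 2 = ∑ n ∈ F, ‖c n‖ ^ 2 := by
  have h : inner ℂ (torusPolyLp F c) (torusPolyLp F c) = ∑ n ∈ F, starRingEnd ℂ (c n) * c n :=
    UnitAddTorus.orthonormal_mFourier.inner_sum c c F
  rw [inner_self_eq_norm_sq_to_K] at h
  have h2 : ((‖torusPolyLp F c‖ ^ 2 : ℝ) : ℂ) = ((∑ n ∈ F, ‖c n‖ ^ 2 : ℝ) : ℂ) := by
    push_cast
    refine h.trans (Finset.sum_congr rfl fun n _ => ?_)
    rw [Complex.conj_mul']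
  exact_mod_cast h2

theorem lintegral_torusPoly_sq {d : ℕ} (F : Finset (Fin d → ℤ)) (c : (Fin d → ℤ) → ℂ) :
    ∫⁻ y, ‖torusPoly F c y‖ₑ ^ 2 ∂torusMeasure d = ENNReal.ofReal (∑ n ∈ F, ‖c n‖ ^ 2) := by
  rw [← norm_sq_torusPolyLp, ENNReal.ofReal_pow (norm_nonneg _), ofReal_norm,
    ← lintegral_enorm_sq_eq]
  refine lintegral_congr_ae ?_
  filter_upwards [coeFn_torusPolyLp F c] with y hy
  rw [hy]

/-! ### The localization estimate -/

theorem eLpNorm_cutoffPoly_le {d : ℕ} {φ : EuclideanSpace ℝ (Fin d) → ℝ}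
    (hφ : ContDiff ℝ (⊤ : ℕ∞) φ) (hφc : HasCompactSupport φ) (hφ0 : ∀ x, 0 ≤ φ x)
    (hφ1 : ∀ x, φ x ≤ 1) (hφs : Function.support φ ⊆ unitCube d) (F : Finset (Fin d → ℤ))
    (c : (Fin d → ℤ) → ℂ) :
    eLpNorm (cutoffPoly hφ hφc F c) 2 volume ≤ ENNReal.ofReal √(∑ n ∈ F, ‖c n‖ ^ 2) := by
  refine eLpNorm_two_le_of_lintegral_le (by positivity) ?_
  rw [Real.sq_sqrt (Finset.sum_nonneg fun n _ => by positivity), ← lintegral_torusPoly_sq,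
    lintegral_torus_eq, ← lintegral_indicator]
  · refine lintegral_mono fun x => ?_
    rw [cutoffPoly_apply]
    by_cases hx : x ∈ unitCube d
    · rw [Set.indicator_of_mem hx]
      gcongr 1
      rw [enorm_mul]
      refine mul_le_of_le_one_right' ?_
      rw [← ofReal_norm, Complex.norm_real, Real.norm_of_nonneg (hφ0 x)]
      simpa using hφ1 x
    · have : φ x = 0 := by
        by_contra h
        exact hx (hφs h)
      simp [this]
  · have : unitCube d = ⋂ i, (fun x : EuclideanSpace ℝ (Fin d) => x i) ⁻¹' Set.Ioc (0 : ℝ) 1 := by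
      ext x; simp [unitCube]
    rw [this]
    exact MeasurableSet.iInter fun i =>
      (by fun_prop : Measurable fun x : EuclideanSpace ℝ (Fin d) => x i) measurableSet_Ioc

theorem hsNormRd_schwartz {d : ℕ} {s : ℝ} (f : SchwartzMap (EuclideanSpace ℝ (Fin d)) ℂ) :
    hsNormRd s (f.toLp 2) =
      eLpNorm (fun ξ => ((((2 * Real.pi * ‖ξ‖) ^ s : ℝ) : ℂ)) * 𝓕 f ξ) 2 volume := by
  rw [hsNormRd, eLpNorm_eq_lintegral_rpow_enorm_toReal (by norm_num) (by norm_num)]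
  simp only [ENNReal.toReal_ofNat, ENNReal.rpow_ofNat]
  congr 1
  rw [SchwartzMap.toLp_fourier_eq]
  refine lintegral_congr_ae ?_
  filter_upwards [(𝓕 f).coeFn_toLp 2 volume] with ξ hξ
  rw [hξ, enorm_mul, mul_pow]
  congr 1
  rw [← ofReal_norm, Complex.norm_real, Real.norm_of_nonneg (by positivity),
    ← ENNReal.ofReal_pow (by positivity), ← Real.rpow_natCast, ← Real.rpow_mul (by positivity)]
  push_cast
  rw [mul_comm s]

theorem eLpNorm_fourier_schwartz {d : ℕ} (f : SchwartzMap (EuclideanSpace ℝ (Fin d)) ℂ) :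
    eLpNorm (𝓕 f : SchwartzMap (EuclideanSpace ℝ (Fin d)) ℂ) 2 volume = eLpNorm f 2 volume := by
  have h := congrArg ENNReal.ofReal (SchwartzMap.norm_fourier_toL2_eq f)
  rw [ofReal_norm, ofReal_norm, Lp.enorm_def, Lp.enorm_def,
    eLpNorm_congr_ae ((𝓕 f).coeFn_toLp 2 volume), eLpNorm_congr_ae (f.coeFn_toLp 2 volume)] at h
  exact h

/-- A cutoff `0 ≤ φ ≤ 1` supported in the unit cube increases the `Ḣ^s` norm at most by the factor
`1 + ε`, up to a multiple of the `L²` norm. Since `𝓕(φ u)(ξ) = ∑ₙ cₙ 𝓕φ(ξ - n)`, replacing the weight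
`|2πξ|^s` by `|2πn|^s` in each summand produces the cutoff of `|D|^s u`, whose `L²` norm is at most
`‖|D|^s u‖_{L²}`; the difference is small by the symbol estimate and Schur's test. -/
theorem exists_hsNormRd_cutoffPoly_le {d : ℕ} (hd : 1 ≤ d) {s : ℝ} (hs : 0 < s)
    {φ : EuclideanSpace ℝ (Fin d) → ℝ}
    (hφ : ContDiff ℝ (⊤ : ℕ∞) φ) (hφc : HasCompactSupport φ) (hφ0 : ∀ x, 0 ≤ φ x)
    (hφ1 : ∀ x, φ x ≤ 1) (hφs : Function.support φ ⊆ unitCube d) {ε : ℝ} (hε : 0 < ε) :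
    ∃ C : ℝ, 0 < C ∧ ∀ (F : Finset (Fin d → ℤ)) (c : (Fin d → ℤ) → ℂ),
      hsNormRd s ((cutoffPoly hφ hφc F c).toLp 2) ≤
        ENNReal.ofReal ((1 + ε) * √(∑ n ∈ F, (2 * Real.pi * freqNorm n) ^ (2 * s) * ‖c n‖ ^ 2) +
          C * √(∑ n ∈ F, ‖c n‖ ^ 2)) := by
  set Φ : SchwartzMap (EuclideanSpace ℝ (Fin d)) ℂ := HasCompactSupport.toSchwartzMap
    (f := fun x => (φ x : ℂ)) (hφc.comp_left (g := fun t : ℝ => (t : ℂ)) Complex.ofReal_zero)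
    (Complex.ofRealCLM.contDiff.comp hφ) with hΦ
  set w : EuclideanSpace ℝ (Fin d) → ℝ := fun ξ => (2 * Real.pi * ‖ξ‖) ^ s with hw
  have hw0 : ∀ ξ, 0 ≤ w ξ := fun ξ => by positivity
  have hwm : Measurable w := by fun_prop
  have hΦm : Measurable fun ξ => ‖𝓕 Φ ξ‖ := (𝓕 Φ).continuous.norm.measurable
  have hF : ∀ F c ξ, 𝓕 (cutoffPoly hφ hφc F c) ξ = ∑ n ∈ F, c n * 𝓕 Φ (ξ - freq n) :=
    fun F c ξ => fourier_torusPoly_mul F c (Φ.integrable) ξ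
  obtain ⟨C₀, hC₀, h₀⟩ := exists_schwartz_norm_le (𝓕 Φ) (s + 2 * d)
  have hK : ∀ ξ, w ξ * ‖𝓕 Φ ξ‖ ≤ ((2 * Real.pi) ^ s * C₀) * (1 + ‖ξ‖) ^ (-(2 * d : ℝ)) := by
    intro ξ
    have h1 : 0 < 1 + ‖ξ‖ := by positivity
    calc _ ≤ (2 * Real.pi * (1 + ‖ξ‖)) ^ s * (C₀ * (1 + ‖ξ‖) ^ (-(s + 2 * d))) := by
          gcongr
          · rw [hw]; simp only; gcongr; linarith
          · exact h₀ ξ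
      _ = _ := by
          rw [Real.mul_rpow (by positivity) h1.le]
          have : (1 + ‖ξ‖) ^ (-(2 * d : ℝ)) = (1 + ‖ξ‖) ^ s * (1 + ‖ξ‖) ^ (-(s + 2 * d)) := by
            rw [← Real.rpow_add h1]; congr 1; ring
          rw [this]; ring
  have hK' : ∀ ξ, ‖𝓕 Φ ξ‖ ≤ C₀ * (1 + ‖ξ‖) ^ (-(2 * d : ℝ)) := by
    intro ξ
    refine (h₀ ξ).trans ?_
    gcongr
    · linarith [norm_nonneg ξ]
    · linarith
  obtain ⟨M₀, hM₀, hY₀⟩ := exists_eLpNorm_sum_translates_le hd hΦm (fun ξ => norm_nonneg _)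
    hC₀.le hK'
  obtain ⟨M₁, hM₁, hY₁⟩ := exists_eLpNorm_sum_translates_le hd (hwm.mul hΦm)
    (fun ξ => mul_nonneg (hw0 ξ) (norm_nonneg _)) (by positivity) hK
  -- Schur's test costs the factor `M₀`, so the symbol estimate is used with `ε / (M₀ + 1)`.
  have hε' : 0 < ε / (M₀ + 1) := by positivity
  obtain ⟨C₁, hC₁, hrpow⟩ := exists_abs_rpow_sub_rpow_le hs.le hε'
  refine ⟨C₁ * M₁ + 1, by positivity, fun F c => ?_⟩
  set b : (Fin d → ℤ) → ℝ := fun n => w (freq n) * ‖c n‖ with hb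
  have hbsq : ∀ n, b n ^ 2 = (2 * Real.pi * freqNorm n) ^ (2 * s) * ‖c n‖ ^ 2 := by
    intro n
    simp only [hb, hw, norm_freq]
    rw [mul_pow, mul_comm 2 s, Real.rpow_mul (by rw [← norm_freq]; positivity), Real.rpow_ofNat]
  set X := √(∑ n ∈ F, (2 * Real.pi * freqNorm n) ^ (2 * s) * ‖c n‖ ^ 2) with hX
  set Y := √(∑ n ∈ F, ‖c n‖ ^ 2) with hY
  -- The Fourier coefficients of `|D|^s u`.
  set c' : (Fin d → ℤ) → ℂ := fun n => (w (freq n) : ℂ) * c n with hc'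
  have hc'n : ∀ n, ‖c' n‖ = b n := by
    intro n
    rw [hc', norm_mul, Complex.norm_real, Real.norm_of_nonneg (hw0 _)]
  set G₀ : EuclideanSpace ℝ (Fin d) → ℂ := fun ξ => 𝓕 (cutoffPoly hφ hφc F c') ξ with hG₀
  set G₁ : EuclideanSpace ℝ (Fin d) → ℝ := fun ξ => ∑ n ∈ F, ‖𝓕 Φ (ξ - freq n)‖ * b n with hG₁
  set G₂ : EuclideanSpace ℝ (Fin d) → ℝ := fun ξ => ∑ n ∈ F,
    (w (ξ - freq n) * ‖𝓕 Φ (ξ - freq n)‖) * ‖c n‖ with hG₂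
  have hG₀X : eLpNorm G₀ 2 volume ≤ ENNReal.ofReal X := by
    rw [hG₀, eLpNorm_fourier_schwartz]
    refine (eLpNorm_cutoffPoly_le hφ hφc hφ0 hφ1 hφs F c').trans (le_of_eq ?_)
    simp_rw [hc'n, hbsq, hX]
  have hG₁X : eLpNorm G₁ 2 volume ≤ ENNReal.ofReal (M₀ * X) := by
    refine (hY₀ F b).trans (le_of_eq ?_)
    simp_rw [hbsq, hX]
  have hG₂Y : eLpNorm G₂ 2 volume ≤ ENNReal.ofReal (M₁ * Y) := hY₁ F fun n => ‖c n‖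
  have hG₀m : AEStronglyMeasurable (fun ξ => ‖G₀ ξ‖) volume :=
    (𝓕 (cutoffPoly hφ hφc F c')).continuous.norm.aestronglyMeasurable
  have hG₁m : Measurable G₁ := Finset.measurable_sum _ fun n _ =>
    (hΦm.comp (measurable_id.sub_const _)).mul_const _
  have hG₂m : Measurable G₂ := Finset.measurable_sum _ fun n _ =>
    ((hwm.mul hΦm).comp (measurable_id.sub_const _)).mul_const _
  have hpt : ∀ ξ, ‖((w ξ : ℝ) : ℂ) * 𝓕 (cutoffPoly hφ hφc F c) ξ‖ ≤
      ‖G₀ ξ‖ + (ε / (M₀ + 1)) * G₁ ξ + C₁ * G₂ ξ := by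
    intro ξ
    have hsplit : ((w ξ : ℝ) : ℂ) * 𝓕 (cutoffPoly hφ hφc F c) ξ = G₀ ξ +
        ∑ n ∈ F, ((w ξ - w (freq n) : ℝ) : ℂ) * c n * 𝓕 Φ (ξ - freq n) := by
      simp only [hG₀, hF, Finset.mul_sum, ← Finset.sum_add_distrib, hc']
      refine Finset.sum_congr rfl fun n _ => ?_
      push_cast
      ring
    rw [hsplit, add_assoc]
    refine (norm_add_le _ _).trans ?_
    gcongr
    refine (norm_sum_le _ _).trans ?_
    rw [hG₁, hG₂]
    simp only [Finset.mul_sum, ← Finset.sum_add_distrib]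
    refine Finset.sum_le_sum fun n _ => ?_
    rw [norm_mul, norm_mul, Complex.norm_real, Real.norm_eq_abs]
    have h1 : |w ξ - w (freq n)| ≤ ε / (M₀ + 1) * w (freq n) + C₁ * w (ξ - freq n) := by
      refine hrpow _ _ _ (by positivity) (by positivity) ?_
      rw [← mul_sub, abs_mul, abs_of_pos (by positivity : 0 < 2 * Real.pi)]
      gcongr
      exact abs_norm_sub_norm_le _ _
    calc _ ≤ (ε / (M₀ + 1) * w (freq n) + C₁ * w (ξ - freq n)) * ‖c n‖ * ‖𝓕 Φ (ξ - freq n)‖ := by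
          gcongr
      _ = _ := by rw [hb]; ring
  rw [hsNormRd_schwartz]
  calc _ ≤ eLpNorm (fun ξ => ‖G₀ ξ‖ + (ε / (M₀ + 1)) * G₁ ξ + C₁ * G₂ ξ) 2 volume :=
        eLpNorm_mono_real hpt
    _ ≤ eLpNorm (fun ξ => ‖G₀ ξ‖) 2 volume + eLpNorm (fun ξ => (ε / (M₀ + 1)) * G₁ ξ) 2 volume +
        eLpNorm (fun ξ => C₁ * G₂ ξ) 2 volume := by
        refine (eLpNorm_add_le (hG₀m.add (hG₁m.const_mul _).aestronglyMeasurable)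
          (hG₂m.const_mul _).aestronglyMeasurable (by norm_num)).trans ?_
        gcongr
        exact eLpNorm_add_le hG₀m (hG₁m.const_mul _).aestronglyMeasurable (by norm_num)
    _ ≤ ENNReal.ofReal X + ENNReal.ofReal (ε / (M₀ + 1)) * ENNReal.ofReal (M₀ * X) +
        ENNReal.ofReal C₁ * ENNReal.ofReal (M₁ * Y) := by
        have e1 : eLpNorm (fun ξ => (ε / (M₀ + 1)) * G₁ ξ) 2 volume =
            ENNReal.ofReal (ε / (M₀ + 1)) * eLpNorm G₁ 2 volume := by
          rw [← Real.enorm_of_nonneg hε'.le]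
          exact eLpNorm_const_smul (ε / (M₀ + 1)) G₁ 2 volume
        have e2 : eLpNorm (fun ξ => C₁ * G₂ ξ) 2 volume =
            ENNReal.ofReal C₁ * eLpNorm G₂ 2 volume := by
          rw [← Real.enorm_of_nonneg hC₁.le]
          exact eLpNorm_const_smul C₁ G₂ 2 volume
        rw [e1, e2, eLpNorm_norm]
        gcongr
    _ ≤ _ := by
        have hX0 : 0 ≤ X := Real.sqrt_nonneg _
        have hY0 : 0 ≤ Y := Real.sqrt_nonneg _
        rw [← ENNReal.ofReal_mul (by positivity), ← ENNReal.ofReal_mul (by positivity),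
          ← ENNReal.ofReal_add (by positivity) (by positivity),
          ← ENNReal.ofReal_add (by positivity) (by positivity)]
        apply ENNReal.ofReal_le_ofReal
        have : ε / (M₀ + 1) * M₀ ≤ ε := by
          rw [div_mul_eq_mul_div, div_le_iff₀ (by positivity)]
          linarith
        have h2 := mul_le_mul_of_nonneg_right this hX0
        linarith

/-! ### The inequality for trigonometric polynomials -/

/-- Smooth cutoffs of the unit cube with `∫ φ^p` arbitrarily close to `1`. -/
theorem exists_cutoff (d : ℕ) {η : ℝ} (hη : 0 < η) (p : ℝ) :
    ∃ φ : EuclideanSpace ℝ (Fin d) → ℝ, ContDiff ℝ (⊤ : ℕ∞) φ ∧ HasCompactSupport φ ∧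
      (∀ x, 0 ≤ φ x) ∧ (∀ x, φ x ≤ 1) ∧ Function.support φ ⊆ unitCube d ∧
      ENNReal.ofReal (1 - η) ≤ ∫⁻ x, ENNReal.ofReal (φ x ^ p) := by
  set U : Set (EuclideanSpace ℝ (Fin d)) := {x | ∀ i, x i ∈ Set.Ioo (0 : ℝ) 1} with hU
  have hU' : U = (WithLp.ofLp : EuclideanSpace ℝ (Fin d) → Fin d → ℝ) ⁻¹'
      (Set.univ.pi fun _ => Set.Ioo 0 1) := by
    ext x; simp [hU]
  have hUo : IsOpen U := by
    rw [hU']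
    exact (isOpen_set_pi Set.finite_univ fun _ _ => isOpen_Ioo).preimage
      (PiLp.continuous_ofLp 2 _)
  have hUv : volume U = 1 := by
    rw [hU', (PiLp.volume_preserving_ofLp (Fin d)).measure_preimage
      (MeasurableSet.univ_pi fun _ => measurableSet_Ioo).nullMeasurableSet, Real.volume_pi_Ioo]
    simp
  have hUb : Bornology.IsBounded U := by
    refine (Metric.isBounded_closedBall (x := (0 : EuclideanSpace ℝ (Fin d)))
      (r := √d)).subset fun x hx => ?_
    rw [mem_closedBall_zero_iff, EuclideanSpace.norm_eq]
    apply Real.sqrt_le_sqrt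
    calc ∑ i, ‖x i‖ ^ 2 ≤ ∑ _i : Fin d, (1 : ℝ) := by
          refine Finset.sum_le_sum fun i _ => ?_
          rw [Real.norm_of_nonneg (hx i).1.le]
          exact pow_le_one₀ (hx i).1.le (hx i).2.le
      _ = d := by simp
  have hlt : ENNReal.ofReal (1 - η) < volume U := by
    rw [hUv, ← ENNReal.ofReal_one, ENNReal.ofReal_lt_ofReal_iff one_pos]
    linarith
  obtain ⟨K, hKU, hKc, hK⟩ := hUo.exists_lt_isCompact hlt
  obtain ⟨φ, hφ, hφr, hφs, hφK⟩ := exists_contMDiff_support_eq_eq_one_iff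
    (modelWithCornersSelf ℝ (EuclideanSpace ℝ (Fin d))) (n := (⊤ : ℕ∞)) hUo hKc.isClosed hKU
  have h01 : ∀ x, φ x ∈ Set.Icc (0 : ℝ) 1 := fun x => hφr ⟨x, rfl⟩
  refine ⟨φ, hφ.contDiff, ?_, fun x => (h01 x).1, fun x => (h01 x).2, ?_, ?_⟩
  · rw [HasCompactSupport, tsupport, hφs]
    exact hUb.isCompact_closure
  · rw [hφs]
    exact fun x hx i => ⟨(hx i).1, (hx i).2.le⟩
  · refine hK.le.trans ?_
    rw [← lintegral_indicator_one hKc.measurableSet]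
    refine lintegral_mono fun x => ?_
    by_cases hx : x ∈ K
    · simp [hx, (hφK x).1 hx]
    · simp [hx]

theorem lintegral_lintegral_mul_translate {d : ℕ} {w : EuclideanSpace ℝ (Fin d) → ℝ≥0∞}
    (hw : Measurable w) {f : UnitAddTorus (Fin d) → ℝ≥0∞} (hf : Measurable f) :
    ∫⁻ a, (∫⁻ x, w x * f (a + toTorus x)) ∂torusMeasure d =
      (∫⁻ x, w x) * ∫⁻ y, f y ∂torusMeasure d := by
  rw [lintegral_lintegral_swap]
  · rw [← lintegral_mul_const _ hw]
    refine lintegral_congr fun x => ?_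
    rw [lintegral_const_mul _ (show Measurable fun a => f (a + toTorus x) from
      hf.comp (measurable_id.add_const _)),
      lintegral_add_right_eq_self f (toTorus x)]
  · refine Measurable.aemeasurable ?_
    exact (hw.comp measurable_snd).mul
      (hf.comp (measurable_fst.add (measurable_toTorus.comp measurable_snd)))

theorem continuous_torusPoly {d : ℕ} (F : Finset (Fin d → ℤ)) (c : (Fin d → ℤ) → ℂ) :
    Continuous (torusPoly F c) :=
  continuous_finsetSum F fun n _ => continuous_const.mul (UnitAddTorus.mFourier n).continuous

theorem torusPoly_add {d : ℕ} (F : Finset (Fin d → ℤ)) (c : (Fin d → ℤ) → ℂ)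
    (a y : UnitAddTorus (Fin d)) :
    torusPoly F c (a + y) = torusPoly F (fun n => c n * UnitAddTorus.mFourier n a) y := by
  refine Finset.sum_congr rfl fun n _ => ?_
  have : UnitAddTorus.mFourier n (a + y) =
      UnitAddTorus.mFourier n a * UnitAddTorus.mFourier n y := by
    simp only [UnitAddTorus.mFourier, ContinuousMap.coe_mk, Pi.add_apply, fourier_apply,
      smul_add, AddCircle.toCircle_add, Circle.coe_mul, Finset.prod_mul_distrib]
  rw [this, mul_assoc]

theorem norm_mFourier_apply {d : ℕ} (n : Fin d → ℤ) (a : UnitAddTorus (Fin d)) :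
    ‖UnitAddTorus.mFourier n a‖ = 1 := by
  simp only [UnitAddTorus.mFourier, ContinuousMap.coe_mk, fourier_apply, norm_prod]
  exact Finset.prod_eq_one fun i _ => Circle.norm_coe _

/-- Averaging over translations: a translation only changes the phases of the coefficients, so a bound
for the cutoffs that depends only on their moduli gives a bound on the whole torus, with the loss
`∫ φ^p`. -/
theorem lintegral_torusPoly_rpow_le_of_cutoff {d : ℕ} {p : ℝ} (hp : 0 < p)
    {φ : EuclideanSpace ℝ (Fin d) → ℝ} (hφ : ContDiff ℝ (⊤ : ℕ∞) φ) (hφc : HasCompactSupport φ)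
    (hφ0 : ∀ x, 0 ≤ φ x) (F : Finset (Fin d → ℤ)) (c : (Fin d → ℤ) → ℂ) {R : ℝ≥0∞}
    (h : ∀ c' : (Fin d → ℤ) → ℂ, (∀ n, ‖c' n‖ = ‖c n‖) →
      eLpNorm (cutoffPoly hφ hφc F c') (ENNReal.ofReal p) volume ^ p ≤ R) :
    (∫⁻ x, ENNReal.ofReal (φ x ^ p)) * ∫⁻ y, ‖torusPoly F c y‖ₑ ^ p ∂torusMeasure d ≤ R := by
  have hw : Measurable fun x => ENNReal.ofReal (φ x ^ p) :=
    (hφ.continuous.measurable.pow_const p).ennreal_ofReal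
  rw [← lintegral_lintegral_mul_translate hw
    ((continuous_torusPoly F c).measurable.enorm.pow_const p)]
  calc _ ≤ ∫⁻ _a, R ∂torusMeasure d := by
        refine lintegral_mono fun a => ?_
        refine le_trans (le_of_eq ?_) (h (fun n => c n * UnitAddTorus.mFourier n a)
          fun n => by rw [norm_mul, norm_mFourier_apply, mul_one])
        rw [eLpNorm_ofReal_rpow hp]
        refine lintegral_congr fun x => ?_
        rw [cutoffPoly_apply, enorm_mul, ENNReal.mul_rpow_of_nonneg _ _ hp.le, ← torusPoly_add,
          mul_comm, ← ofReal_norm (φ x : ℂ), Complex.norm_real, Real.norm_of_nonneg (hφ0 x),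
          ENNReal.ofReal_rpow_of_nonneg (hφ0 x) hp.le]
    _ = R := by simp

theorem exists_pos_mul_rpow_div_le {G δ α : ℝ} (hδ : 0 < δ) :
    ∃ ε : ℝ, 0 < ε ∧ ε < 1 ∧ G * ((1 + ε) * (1 + ε) ^ α) / (1 - ε) ≤ G + δ := by
  have hc : ContinuousAt (fun ε : ℝ => G * ((1 + ε) * (1 + ε) ^ α) / (1 - ε)) 0 := by
    refine ContinuousAt.div (continuousAt_const.mul ((by fun_prop : ContinuousAt _ _).mul
      (ContinuousAt.rpow_const (by fun_prop) (Or.inl (by norm_num))))) (by fun_prop) (by norm_num)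
  have h := hc.tendsto
  simp only [add_zero, Real.one_rpow, mul_one, sub_zero, div_one] at h
  have h' := (h.mono_left (nhdsWithin_le_nhds (s := Set.Ioi 0))).eventually
    (ge_mem_nhds (show G < G + δ by linarith))
  obtain ⟨ε, h1, h2, h3⟩ := (h'.and ((eventually_mem_nhdsWithin (a := (0 : ℝ)) (s := Set.Ioi 0)).and
    (nhdsWithin_le_nhds (eventually_lt_nhds (show (0 : ℝ) < 1 by norm_num))))).exists
  exact ⟨ε, h2, h3, h1⟩

theorem exists_torusPoly_le {d : ℕ} (hd : 1 ≤ d) {s p : ℝ} (hs : 0 < s) (hp : 2 < p)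
    (hps : 2 * s < d → p ≤ 2 * d / (d - 2 * s)) {δ : ℝ} (hδ : 0 < δ) :
    ∃ C : ℝ, 0 < C ∧ ∀ (F : Finset (Fin d → ℤ)) (c : (Fin d → ℤ) → ℂ),
      ∫⁻ y, ‖torusPoly F c y‖ₑ ^ p ∂torusMeasure d ≤ ENNReal.ofReal
        (((sharpConst d p s).toReal + δ) *
          √(∑ n ∈ F, (2 * Real.pi * freqNorm n) ^ (2 * s) * ‖c n‖ ^ 2) ^ ((p - 2) * d / (2 * s)) *
          √(∑ n ∈ F, ‖c n‖ ^ 2) ^ (2 + (p - 2) / (2 * s) * (2 * s - d)) +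
        C * √(∑ n ∈ F, ‖c n‖ ^ 2) ^ p) := by
  have hp0 : 0 < p := by linarith
  set G : ℝ := (sharpConst d p s).toReal with hG
  have hG0 : 0 ≤ G := ENNReal.toReal_nonneg
  have hGe : sharpConst d p s = ENNReal.ofReal G :=
    (ENNReal.ofReal_toReal (sharpConst_lt_top hd hs hp hps).ne).symm
  set α : ℝ := (p - 2) * d / (2 * s) with hα
  set β : ℝ := 2 + (p - 2) / (2 * s) * (2 * s - d) with hβ
  have hα0 : 0 ≤ α := homogeneous_exponent_nonneg hs hp
  have hβ0 : 0 ≤ β := mass_exponent_nonneg hs hp hps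
  have hαβ : α + β = p := by rw [hβ, mass_exponent_eq hs]; ring
  obtain ⟨ε, hε0, hε1, hε⟩ := exists_pos_mul_rpow_div_le (G := G) (α := α) hδ
  obtain ⟨φ, hφ, hφc, hφ0, hφ1, hφs, hφI⟩ := exists_cutoff d hε0 p
  obtain ⟨C₁, hC₁, h₁⟩ := exists_hsNormRd_cutoffPoly_le hd hs hφ hφc hφ0 hφ1 hφs hε0
  obtain ⟨C₂, hC₂, h₂⟩ := exists_add_rpow_le hα0 hε0
  have hε1' : 0 < 1 - ε := by linarith
  refine ⟨G * (C₂ * C₁ ^ α) / (1 - ε) + 1, by positivity, fun F c => ?_⟩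
  set X := √(∑ n ∈ F, (2 * Real.pi * freqNorm n) ^ (2 * s) * ‖c n‖ ^ 2) with hX
  set Y := √(∑ n ∈ F, ‖c n‖ ^ 2) with hY
  have hX0 : 0 ≤ X := Real.sqrt_nonneg _
  have hY0 : 0 ≤ Y := Real.sqrt_nonneg _
  have key := lintegral_torusPoly_rpow_le_of_cutoff hp0 hφ hφc hφ0 F c
    (R := ENNReal.ofReal (G * (((1 + ε) * X + C₁ * Y) ^ α * Y ^ β))) (by
      intro c' hc'
      have hm := memHsRd_schwartz hs (cutoffPoly hφ hφc F c')
      have h := eLpNorm_rpow_le_sharpConst hd hs hp hps hm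
      have e1 := (cutoffPoly hφ hφc F c').coeFn_toLp 2 volume
      rw [eLpNorm_congr_ae e1, eLpNorm_congr_ae e1, hGe] at h
      refine h.trans ?_
      have hX' := h₁ F c'
      have hY' := eLpNorm_cutoffPoly_le hφ hφc hφ0 hφ1 hφs F c'
      simp only [hc'] at hX' hY'
      rw [ENNReal.ofReal_mul hG0, ENNReal.ofReal_mul (by positivity),
        ← ENNReal.ofReal_rpow_of_nonneg (by positivity) hα0,
        ← ENNReal.ofReal_rpow_of_nonneg hY0 hβ0]
      gcongr)
  have hreal : G * (((1 + ε) * X + C₁ * Y) ^ α * Y ^ β) ≤ (1 - ε) *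
      ((G + δ) * X ^ α * Y ^ β + (G * (C₂ * C₁ ^ α) / (1 - ε) + 1) * Y ^ p) := by
    have hb := h₂ ((1 + ε) * X) (C₁ * Y) (by positivity) (by positivity)
    rw [Real.mul_rpow (by positivity) hX0, Real.mul_rpow hC₁.le hY0] at hb
    have hYp : Y ^ p = Y ^ α * Y ^ β := by
      rw [← hαβ, Real.rpow_add_of_nonneg hY0 hα0 hβ0]
    rw [div_le_iff₀ hε1'] at hε
    calc G * (((1 + ε) * X + C₁ * Y) ^ α * Y ^ β)
        ≤ G * (((1 + ε) * ((1 + ε) ^ α * X ^ α) + C₂ * (C₁ ^ α * Y ^ α)) * Y ^ β) := by gcongr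
      _ = (G * ((1 + ε) * (1 + ε) ^ α)) * (X ^ α * Y ^ β) + G * (C₂ * C₁ ^ α) * Y ^ p := by
          rw [hYp]; ring
      _ ≤ ((G + δ) * (1 - ε)) * (X ^ α * Y ^ β) + G * (C₂ * C₁ ^ α) * Y ^ p
            + (1 - ε) * Y ^ p := by
          have : 0 ≤ (1 - ε) * Y ^ p := by positivity
          have h3 := mul_le_mul_of_nonneg_right hε (show 0 ≤ X ^ α * Y ^ β by positivity)
          linarith
      _ = _ := by field_simp; ring
  have h3 : ENNReal.ofReal (1 - ε) * ∫⁻ y, ‖torusPoly F c y‖ₑ ^ p ∂torusMeasure d ≤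
      ENNReal.ofReal (1 - ε) * ENNReal.ofReal
        ((G + δ) * X ^ α * Y ^ β + (G * (C₂ * C₁ ^ α) / (1 - ε) + 1) * Y ^ p) := by
    rw [← ENNReal.ofReal_mul hε1'.le]
    exact (mul_le_mul_left hφI _).trans (key.trans (ENNReal.ofReal_le_ofReal hreal))
  exact (ENNReal.mul_le_mul_iff_right (by simpa using hε1) ENNReal.ofReal_ne_top).1 h3

/-! ### Passage to general functions on the torus -/

theorem ofReal_sqrt_sum_le_eLpNorm {d : ℕ} (u : L2Td d) (F : Finset (Fin d → ℤ)) :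
    ENNReal.ofReal √(∑ n ∈ F, ‖UnitAddTorus.mFourierCoeff u n‖ ^ 2) ≤
      eLpNorm u 2 (torusMeasure d) := by
  rw [← Lp.enorm_def, ← ofReal_norm]
  apply ENNReal.ofReal_le_ofReal
  refine Real.sqrt_le_iff.2 ⟨norm_nonneg _, ?_⟩
  have h := UnitAddTorus.orthonormal_mFourier.sum_inner_products_le (x := u) (s := F)
  refine le_trans (le_of_eq ?_) h
  refine Finset.sum_congr rfl fun n _ => ?_
  rw [← UnitAddTorus.mFourierBasis_repr, HilbertBasis.repr_apply_apply,
    UnitAddTorus.coe_mFourierBasis]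

theorem ofReal_sqrt_sum_le_hsNormTd {d : ℕ} {s : ℝ} (hs : 0 < s) (u : L2Td d)
    (F : Finset (Fin d → ℤ)) :
    ENNReal.ofReal √(∑ n ∈ F, (2 * Real.pi * freqNorm n) ^ (2 * s) *
      ‖UnitAddTorus.mFourierCoeff u n‖ ^ 2) ≤ hsNormTd s u := by
  have hn : ∀ n : Fin d → ℤ, 0 ≤ 2 * Real.pi * freqNorm n := fun n => by
    rw [← norm_freq]; positivity
  have hnn : ∀ n : Fin d → ℤ, 0 ≤ (2 * Real.pi * freqNorm n) ^ (2 * s) := fun n =>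
    Real.rpow_nonneg (hn n) _
  rw [Real.sqrt_eq_rpow, ← ENNReal.ofReal_rpow_of_nonneg
    (Finset.sum_nonneg fun n _ => mul_nonneg (hnn n) (by positivity)) (by norm_num), hsNormTd]
  gcongr
  set f : (Fin d → ℤ) → ℝ≥0∞ := fun n => ENNReal.ofReal ((2 * Real.pi * freqNorm n) ^ (2 * s)) *
    ‖UnitAddTorus.mFourierCoeff u n‖ₑ ^ 2 with hf
  have h0 : f 0 = 0 := by
    have : freqNorm (0 : Fin d → ℤ) = 0 := by simp [freqNorm]
    simp [hf, this, Real.zero_rpow (show 2 * s ≠ 0 by positivity)]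
  calc _ = ∑ n ∈ F, f n := by
        rw [ENNReal.ofReal_sum_of_nonneg fun n _ => mul_nonneg (hnn n) (by positivity)]
        refine Finset.sum_congr rfl fun n _ => ?_
        rw [ENNReal.ofReal_mul (hnn n), ENNReal.ofReal_pow (norm_nonneg _), ofReal_norm]
    _ ≤ ∑' n, f n := ENNReal.sum_le_tsum F
    _ = ∑' n : {n : Fin d → ℤ // n ≠ 0}, f n.1 := by
        refine (tsum_subtype_eq_of_support_subset (s := {n : Fin d → ℤ | n ≠ 0}) ?_).symm
        intro n hn' h
        exact hn' (h ▸ h0)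

/-- A uniform `L^p` bound for the Fourier partial sums passes to the function by Fatou's lemma, along an
almost everywhere convergent subsequence. -/
theorem lintegral_rpow_le_of_torusPoly_le {d : ℕ} {p : ℝ} (u : L2Td d) {R : ℝ≥0∞}
    (h : ∀ F : Finset (Fin d → ℤ),
      ∫⁻ y, ‖torusPoly F (UnitAddTorus.mFourierCoeff u) y‖ₑ ^ p ∂torusMeasure d ≤ R) :
    ∫⁻ y, ‖u y‖ₑ ^ p ∂torusMeasure d ≤ R := by
  set c := UnitAddTorus.mFourierCoeff u with hc
  have hL : Filter.Tendsto (fun F => torusPolyLp F c) Filter.atTop (nhds u) :=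
    UnitAddTorus.hasSum_mFourier_series_L2 u
  have hM := tendstoInMeasure_of_tendsto_Lp hL
  obtain ⟨ns, -, hns⟩ := hM.exists_seq_tendsto_ae'
  have hae : ∀ᵐ y ∂torusMeasure d, ∀ i, torusPolyLp (ns i) c y = torusPoly (ns i) c y :=
    ae_all_iff.2 fun i => coeFn_torusPolyLp (ns i) c
  calc ∫⁻ y, ‖u y‖ₑ ^ p ∂torusMeasure d
      = ∫⁻ y, Filter.liminf (fun i => ‖torusPoly (ns i) c y‖ₑ ^ p) Filter.atTop
          ∂torusMeasure d := by
        refine lintegral_congr_ae ?_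
        filter_upwards [hns, hae] with y hy hy'
        simp only [hy'] at hy
        exact ((ENNReal.continuous_rpow_const.tendsto _).comp hy.enorm).liminf_eq.symm
    _ ≤ Filter.liminf (fun i => ∫⁻ y, ‖torusPoly (ns i) c y‖ₑ ^ p ∂torusMeasure d)
          Filter.atTop :=
        lintegral_liminf_le fun i => (continuous_torusPoly _ c).measurable.enorm.pow_const p
    _ ≤ R := Filter.liminf_le_of_frequently_le' (Filter.Frequently.of_forall fun i => h (ns i))

/-! ### Positivity of the sharp constant -/

theorem exists_memHsRd_ne_zero (d : ℕ) {s : ℝ} (hs : 0 < s) :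
    ∃ u : L2Rd d, MemHsRd s u ∧ u ≠ 0 := by
  obtain ⟨φ, hφ, hφc, _, _, _, hI⟩ := exists_cutoff d (η := 1 / 2) (by norm_num) 1
  obtain ⟨f, hf⟩ : ∃ f : SchwartzMap (EuclideanSpace ℝ (Fin d)) ℂ, ∀ x, f x = φ x :=
    ⟨cutoffPoly hφ hφc {0} fun _ => 1, fun x => by
      rw [cutoffPoly_apply, torusPoly, Finset.sum_singleton, UnitAddTorus.mFourier_zero,
        ContinuousMap.one_apply, one_mul, one_mul]⟩
  have hf' := memHsRd_schwartz hs f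
  refine ⟨_, hf', fun h0 => ?_⟩
  rw [Lp.eq_zero_iff_ae_eq_zero] at h0
  have h1 : ∫⁻ x, ENNReal.ofReal (φ x ^ (1 : ℝ)) = 0 := by
    refine (lintegral_congr_ae ?_).trans lintegral_zero
    filter_upwards [h0, f.coeFn_toLp 2 volume] with x hx hx'
    rw [hx', hf, Pi.zero_apply, Complex.ofReal_eq_zero] at hx
    simp only [hx, Real.rpow_one, ENNReal.ofReal_zero]
  rw [h1, nonpos_iff_eq_zero, ENNReal.ofReal_eq_zero] at hI
  exact absurd hI (by norm_num)

end GNS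

end

theorem proposition2p2 (d : ℕ) (hd : 1 ≤ d) (s p : ℝ) (hs : 0 < s) (hp : 2 < p)
    (hps : 2 * s < d → p ≤ 2 * d / (d - 2 * s)) :
    (0 < GNS.sharpConst d p s ∧ GNS.sharpConst d p s < ∞) ∧
    ∀ δ : ℝ≥0, 0 < δ → ∃ C : ℝ≥0, 0 < C ∧
      ∀ u : GNS.L2Td d, GNS.MemHsTd s u →
        eLpNorm u (ENNReal.ofReal p) (GNS.torusMeasure d) ^ p ≤
          (GNS.sharpConst d p s + δ) *
              GNS.hsNormTd s u ^ ((p - 2) * d / (2 * s)) *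
              eLpNorm u 2 (GNS.torusMeasure d) ^ (2 + (p - 2) / (2 * s) * (2 * s - d)) +
            C * eLpNorm u 2 (GNS.torusMeasure d) ^ p := by
  have hp0 : 0 < p := by linarith
  have htop := GNS.sharpConst_lt_top hd hs hp hps
  refine ⟨⟨?_, htop⟩, fun δ hδ => ?_⟩
  · obtain ⟨u, hu, hu0⟩ := GNS.exists_memHsRd_ne_zero d hs
    exact GNS.sharpConst_pos hs hp hps hu hu0
  obtain ⟨C, hC, h⟩ := GNS.exists_torusPoly_le hd hs hp hps (δ := δ) (by exact_mod_cast hδ)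
  refine ⟨C.toNNReal, Real.toNNReal_pos.2 hC, fun u _ => ?_⟩
  rw [GNS.eLpNorm_ofReal_rpow hp0]
  refine GNS.lintegral_rpow_le_of_torusPoly_le u fun F => (h F _).trans ?_
  have hα0 := GNS.homogeneous_exponent_nonneg (d := d) hs hp
  have hβ0 := GNS.mass_exponent_nonneg hs hp hps
  rw [ENNReal.ofReal_add (by positivity) (by positivity), ENNReal.ofReal_mul (by positivity),
    ENNReal.ofReal_mul (by positivity), ENNReal.ofReal_mul hC.le,
    ← ENNReal.ofReal_rpow_of_nonneg (Real.sqrt_nonneg _) hα0,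
    ← ENNReal.ofReal_rpow_of_nonneg (Real.sqrt_nonneg _) hβ0,
    ← ENNReal.ofReal_rpow_of_nonneg (Real.sqrt_nonneg _) hp0.le,
    ENNReal.ofReal_add ENNReal.toReal_nonneg δ.coe_nonneg, ENNReal.ofReal_toReal htop.ne,
    ENNReal.ofReal_coe_nnreal]
  have hX := GNS.ofReal_sqrt_sum_le_hsNormTd hs u F
  have hY := GNS.ofReal_sqrt_sum_le_eLpNorm u F
  change _ ≤ _ + ENNReal.ofReal C * _
  gcongr
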